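/- **Setting.** Let $\Theta\subseteq\mathbb R$ be an interval. For a symmetric kernel $\mathcal K:\Theta^2\to\mathbb R$ with $g_{\mathcal K}(\theta):=\partial^2_{x,y}\mathcal K(\theta,\theta)>0$, let $\mathfrak d_{\mathcal K}(\theta,\theta')=\bigl|\int_\theta^{\theta'}\sqrt{g_{\mathcal K}}\bigr|$. Define covariant derivatives by $D_{0,0}=\mathcal K$, $D_{i+1,j}(\theta,\theta')=g_{\mathcal K}(\theta)^{i/2}\,\partial_\theta\bigl(D_{i,j}(\theta,\theta')/g_{\mathcal K}(\theta)^{i/2}\bigr)$, $D_{i,j}(\theta,\theta')=D_{j,i}(\theta',\theta)$, and set $\mathcal K^{[i,j]}(\theta,\theta')=D_{i,j}(\theta,\theta')\,g_{\mathcal K}(\theta)^{-i/2}g_{\mathcal K}(\theta')^{-j/2}$ and $h_{\mathcal K}(\theta)=\mathcal K^{[3,3]}(\theta,\theta)$. *Limit kernel.* $\mathcal K_\infty$ is a symmetric kernel of class $\mathcal C^{3,3}$ on $\Theta^2$, $g_\infty:=g_{\mathcal K_\infty}$ is positive and of class $\mathcal C^2$ on $\Theta$, $\mathcal K_\infty(\theta,\theta)=-\mathcal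 K_\infty^{[2,0]}(\theta,\theta)=1$ on $\Theta$, and $\Theta_\infty\subseteq\Theta$ is an interval with $\inf_{\Theta_\infty}g_\infty>0$, $L_3:=\sup_{\Theta_\infty}h_{\mathcal K_\infty}<\infty$ and $L_{i,j}:=\sup_{\Theta_\infty^2}|\mathcal K_\infty^{[i,j]}|<\infty$ for $i,j\in\{0,1,2\}$. *Dictionary.* $H_T$ is a real Hilbert space, $\varphi_T:\Theta\to H_T$ is $\mathcal C^3$ with $\|\varphi_T(\theta)\|_T>0$, $\phi_T=\varphi_T/\|\varphi_T\|_T$, and $\|\partial_\theta\phi_T(\theta)\|_T^2>0$ on $\Theta$. Put $\mathcal K_T(\theta,\theta')=\langle\phi_T(\theta),\phi_T(\theta')\rangle_T$ and $\mathfrak d_T=\mathfrak d_{\mathcal K_T}$. $\Theta_T\subseteq\Theta_\infty$ is a compact interval, $|\Theta_T|_{\mathfrak d_T}$ is its $\mathfrak d_T$-diameter, and $$\max\Bigl(\max_{i,j\le2}\sup_{\Theta_T^2}|\mathcal K_T^{[i,j]}-\mathcal K_\infty^{[i,j]}|,\ \sup_{\Theta_T}|h_{\mathcal K_T}-h_{\mathcal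 K_\infty}|\Bigr)\le\min(L_{2,2},L_3).$$ *Model.* $\mathcal Z$ is a finite set with $n$ elements, $\nu=\sum_{z\in\mathcal Z}a_z\delta_z$ with $a_z\ge0$ and $\nu\ne0$, $\|a\|_{\ell_\infty}=\max_z|a_z|$, $L_T=L^2(\nu,H_T)$. For $B\in L^2(\nu,\mathbb R^K)$ and $\vartheta\in\Theta_T^K$ write $B\Phi_T(\vartheta)=\sum_{k=1}^KB_k\,\phi_T(\theta_k)$. We observe $Y=B^\star\Phi_T(\vartheta^\star)+W_T$ in $L_T$ almost surely, with unknown $B^\star\in L^2(\nu,\mathbb R^K)$ and $\vartheta^\star\in\Theta_T^K$. Let $S^\star=\{k:\|B^\star_k\|_{L^2(\nu)}\ne0\}$, $s=\operatorname{Card}S^\star\ge1$, and assume that $\mathcal Q^\star=\{\theta^\star_k:k\in S^\star\}$ has exactly $s$ elements. The $(W_T(z))_{z\in\mathcal Z}$ are independent copies of an $H_T$-valued noise $w_T$ such that for some $\sigma,\Delta_T>0$ and all $f\in H_T$, $\langle f,w_T\rangle_T$ is centered Gaussian with variance at most $\sigma^2\Delta_T\|f\|_T^2$. *Certificates.* Let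 $r>0$, and let $C_N,C_N',C_F,C_B,c_N,c_F,c_B>0$ with $C_F<1$ be constants associated with $r$ and $\mathcal K_\infty$. Write $\mathcal B_T(\theta^\star,r)=\{\theta\in\Theta_T:\mathfrak d_T(\theta^\star,\theta)\le r\}$. Distinct points of $\mathcal Q^\star$ are at $\mathfrak d_T$-distance $>2r$. For every $V:\mathcal Z\times\mathcal Q^\star\to\mathbb R$ with $\|V(\cdot,\theta^\star)\|_{L^2(\nu)}=1$ for all $\theta^\star\in\mathcal Q^\star$, there are $P,Q\in L_T$ with $\|P\|_{L_T}\le C_B\sqrt s$, $\|Q\|_{L_T}\le c_B\sqrt s$ such that, for all $\theta^\star\in\mathcal Q^\star$ and $\theta\in\mathcal B_T(\theta^\star,r)$, $$\|\langle\phi_T(\theta),P\rangle_T\|_{L^2(\nu)}\le1-C_N\mathfrak d_T(\theta^\star,\theta)^2,\qquad \|\langle\phi_T(\theta),P\rangle_T-V(\cdot,\theta^\star)\|_{L^2(\nu)}\le C_N'\mathfrak d_T(\theta^\star,\theta)^2,$$ $$\|\langle\phi_T(\theta),Q\rangle_T-V(\cdot,\theta^\star)\operatorname{sign}(\theta-\theta^\star)\mathfrak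 d_T(\theta,\theta^\star)\|_{L^2(\nu)}\le c_N\mathfrak d_T(\theta^\star,\theta)^2,$$ and, for all $\theta\in\Theta_T\setminus\bigcup_{\theta^\star\in\mathcal Q^\star}\mathcal B_T(\theta^\star,r)$, $\|\langle\phi_T(\theta),P\rangle_T\|_{L^2(\nu)}\le1-C_F$ and $\|\langle\phi_T(\theta),Q\rangle_T\|_{L^2(\nu)}\le c_F$. *Estimators.* For $\kappa>0$, $(\hat B,\hat\vartheta)$ is any minimizer over $B\in L^2(\nu,\mathbb R^K)$, $\vartheta\in\Theta_T^K$ of $$\frac1{2\nu(\mathcal Z)}\|Y-B\Phi_T(\vartheta)\|_{L_T}^2+\kappa\sum_{k=1}^K\|B_k\|_{L^2(\nu)}.$$ **Statement.** There is a universal sequence $F(n)\asymp\sqrt n\,e^{-n/2}$ $(n\ge1)$, and there are constants $\mathcal C_0,\mathcal C_1,\mathcal C_2\in(0,\infty)$, depending only on $\mathcal K_\infty$ (with $\Theta,\Theta_\infty$), on $r$ and on the certificate constants associated with them, such that in every setting as above, for all $\tau>1$ and $$\kappa\ \ge\ \mathcal C_1\,\sigma\sqrt{\frac{\|a\|_{\ell_\infty}\Delta_T\,n}{\nu(\mathcal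 Z)^2}}\Bigl(1+\sqrt{1+\tfrac{\log\tau}n}\Bigr),$$ there is an event of probability at least $$1-\mathcal C_2\Bigl(\frac1\tau+\frac{|\Theta_T|_{\mathfrak d_T}F(n)}{\sqrt\tau}\Bigr)$$ on which every such $(\hat B,\hat\vartheta)$ satisfies $$\frac1{\sqrt{\nu(\mathcal Z)}}\bigl\|\hat B\Phi_T(\hat\vartheta)-B^\star\Phi_T(\vartheta^\star)\bigr\|_{L_T}\le\mathcal C_0\sqrt{s\,\nu(\mathcal Z)}\;\kappa .$$ -/

import Mathlib

open MeasureTheory ProbabilityTheory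
open scoped ENNReal RealInnerProductSpace

noncomputable section

namespace MixtureLasso

/-! ### Kernels on an interval and their covariant derivatives

The interval `Θ` may contain its end points, so derivatives are taken within `Θ`; all notions below
only depend on the values of the functions on `Θ`, respectively on `Θ × Θ`. -/

/-- The partial derivative `∂ₓ F` of `F` on `Θ × Θ`. -/
def partialX (Θ : Set ℝ) (F : ℝ → ℝ → ℝ) : ℝ → ℝ → ℝ :=
  fun x y => derivWithin (fun t => F t y) Θ x

/-- The partial derivative `∂_y F` of `F` on `Θ × Θ`. -/
def partialY (Θ : Set ℝ) (F : ℝ → ℝ → ℝ) : ℝ → ℝ → ℝ :=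
  fun x y => derivWithin (fun t => F x t) Θ y

/-- `F` is of class `C^{i,j}` on `Θ × Θ`. -/
def ClassC (Θ : Set ℝ) : ℕ → ℕ → (ℝ → ℝ → ℝ) → Prop
  | 0, 0, F => ContinuousOn (Function.uncurry F) (Θ ×ˢ Θ)
  | i + 1, 0, F =>
      ContinuousOn (Function.uncurry F) (Θ ×ˢ Θ) ∧
      (∀ y ∈ Θ, ContDiffOn ℝ ((i + 1 : ℕ) : WithTop ℕ∞) (fun x => F x y) Θ) ∧
      ClassC Θ i 0 (partialX Θ F)
  | 0, j + 1, F =>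
      ContinuousOn (Function.uncurry F) (Θ ×ˢ Θ) ∧
      (∀ x ∈ Θ, ContDiffOn ℝ ((j + 1 : ℕ) : WithTop ℕ∞) (fun y => F x y) Θ) ∧
      ClassC Θ 0 j (partialY Θ F)
  | i + 1, j + 1, F =>
      ContinuousOn (Function.uncurry F) (Θ ×ˢ Θ) ∧
      ((∀ y ∈ Θ, ContDiffOn ℝ ((i + 1 : ℕ) : WithTop ℕ∞) (fun x => F x y) Θ) ∧
        ClassC Θ i (j + 1) (partialX Θ F)) ∧
      ((∀ x ∈ Θ, ContDiffOn ℝ ((j + 1 : ℕ) : WithTop ℕ∞) (fun y => F x y) Θ) ∧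
        ClassC Θ (i + 1) j (partialY Θ F))
termination_by i j => i + j

/-- The function `g_K(θ) = ∂²_{x,y} K(θ, θ)`. -/
def kernelMetric (Θ : Set ℝ) (K : ℝ → ℝ → ℝ) (θ : ℝ) : ℝ :=
  partialX Θ (partialY Θ K) θ θ

/-- The metric `𝔡_K(θ, θ') = |G_K(θ) - G_K(θ')|`, with `G_K` a primitive of `√g_K`. -/
def riemDist (Θ : Set ℝ) (K : ℝ → ℝ → ℝ) (θ θ' : ℝ) : ℝ :=
  |∫ t in θ..θ', √(kernelMetric Θ K t)|

/-- The diameter of the set `S ⊆ Θ` with respect to the metric `𝔡_K`. -/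
def riemDiam (Θ : Set ℝ) (K : ℝ → ℝ → ℝ) (S : Set ℝ) : ℝ :=
  sSup ((fun p : ℝ × ℝ => riemDist Θ K p.1 p.2) '' (S ×ˢ S))

/-- The covariant derivatives `D_{i,j;K}[F]` of a symmetric function `F`:
`D_{i+1,j}[F](θ, θ') = g(θ)^{i/2} ∂_θ (D_{i,j}[F](θ, θ') / g(θ)^{i/2})`, where `D_{0,j}[F]` comes from
the same recursion in the second variable (`D_{0,j}[F](θ, θ') = D_{j,0}[F](θ', θ)`). -/
def covDeriv (Θ : Set ℝ) (K F : ℝ → ℝ → ℝ) : ℕ → ℕ → ℝ → ℝ → ℝ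
  | 0, 0 => F
  | 0, j + 1 => fun x y => √(kernelMetric Θ K y) ^ j *
      partialY Θ (fun x' y' => covDeriv Θ K F 0 j x' y' / √(kernelMetric Θ K y') ^ j) x y
  | i + 1, j => fun x y => √(kernelMetric Θ K x) ^ i *
      partialX Θ (fun x' y' => covDeriv Θ K F i j x' y' / √(kernelMetric Θ K x') ^ i) x y

/-- `K^{[i,j]}(θ, θ') = D_{i,j;K}[K](θ, θ') / (g_K(θ)^{i/2} g_K(θ')^{j/2})`. -/
def kernelDeriv (Θ : Set ℝ) (K : ℝ → ℝ → ℝ) (i j : ℕ) (θ θ' : ℝ) : ℝ :=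
  covDeriv Θ K K i j θ θ' / (√(kernelMetric Θ K θ) ^ i * √(kernelMetric Θ K θ') ^ j)

/-- The function `h_K(θ) = K^{[3,3]}(θ, θ)`. -/
def kernelH (Θ : Set ℝ) (K : ℝ → ℝ → ℝ) (θ : ℝ) : ℝ :=
  kernelDeriv Θ K 3 3 θ θ

/-- `L_{i,j} = sup_{S × S} |K^{[i,j]}|`. -/
def supDeriv (Θ S : Set ℝ) (K : ℝ → ℝ → ℝ) (i j : ℕ) : ℝ :=
  sSup ((fun p : ℝ × ℝ => |kernelDeriv Θ K i j p.1 p.2|) '' (S ×ˢ S))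

/-- `L_3 = sup_S h_K`. -/
def supH (Θ S : Set ℝ) (K : ℝ → ℝ → ℝ) : ℝ :=
  sSup (kernelH Θ K '' S)

/-- The properties required of the limit kernel `K` on `Θ × Θ` and of the interval `Θinf ⊆ Θ`. -/
structure IsLimitKernel (Θ Θinf : Set ℝ) (K : ℝ → ℝ → ℝ) : Prop where
  symm : ∀ x ∈ Θ, ∀ y ∈ Θ, K x y = K y x
  smooth : ClassC Θ 3 3 K
  metric_pos : ∀ θ ∈ Θ, 0 < kernelMetric Θ K θ
  metric_smooth : ContDiffOn ℝ 2 (kernelMetric Θ K) Θ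
  diag : ∀ θ ∈ Θ, K θ θ = 1
  diag_two : ∀ θ ∈ Θ, kernelDeriv Θ K 2 0 θ θ = -1
  interval : Θinf.OrdConnected
  subset : Θinf ⊆ Θ
  metric_inf_pos : ∃ m : ℝ, 0 < m ∧ ∀ θ ∈ Θinf, m ≤ kernelMetric Θ K θ
  bdd_h : BddAbove (kernelH Θ K '' Θinf)
  bdd_deriv : ∀ i ≤ 2, ∀ j ≤ 2,
    BddAbove ((fun p : ℝ × ℝ => |kernelDeriv Θ K i j p.1 p.2|) '' (Θinf ×ˢ Θinf))

/-- `max (max_{i,j ≤ 2} sup_{S × S} |K₁^{[i,j]} - K₂^{[i,j]}|, sup_S |h_{K₁} - h_{K₂}|) ≤ δ`. -/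
def KernelsClose (Θ S : Set ℝ) (K₁ K₂ : ℝ → ℝ → ℝ) (δ : ℝ) : Prop :=
  (∀ i ≤ 2, ∀ j ≤ 2, ∀ x ∈ S, ∀ y ∈ S,
    |kernelDeriv Θ K₁ i j x y - kernelDeriv Θ K₂ i j x y| ≤ δ) ∧
  ∀ x ∈ S, |kernelH Θ K₁ x - kernelH Θ K₂ x| ≤ δ

/-! ### The dictionary -/

variable {H : Type*} [NormedAddCommGroup H] [InnerProductSpace ℝ H]

/-- The normalized feature `ϕ(θ) = φ(θ) / ‖φ(θ)‖`. -/
def normFeature (φ : ℝ → H) (θ : ℝ) : H :=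
  ‖φ θ‖⁻¹ • φ θ

/-- The kernel `⟨ϕ(θ), ϕ(θ')⟩` of the dictionary. -/
def dictKernel (φ : ℝ → H) (θ θ' : ℝ) : ℝ :=
  ⟪normFeature φ θ, normFeature φ θ'⟫

/-- The dictionary is `C³` and non-degenerate on `Θ`, and `g(θ) = ‖∂_θ ϕ(θ)‖²` is positive there. -/
structure IsRegularDictionary (Θ : Set ℝ) (φ : ℝ → H) : Prop where
  smooth : ContDiffOn ℝ 3 φ Θ
  norm_pos : ∀ θ ∈ Θ, 0 < ‖φ θ‖
  metric_pos : ∀ θ ∈ Θ, 0 < ‖derivWithin (normFeature φ) Θ θ‖ ^ 2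

/-! ### Mixtures and the penalized least squares problem -/

variable {Z : Type*} [MeasurableSpace Z]

/-- The norm of `L^p(ν, E)`. -/
def normL {E : Type*} [NormedAddCommGroup E] (p : ℝ≥0∞) (ν : Measure Z) (f : Z → E) : ℝ :=
  (eLpNorm f p ν).toReal

/-- The mixture `B Φ(ϑ) = ∑ₖ Bₖ ϕ(ϑₖ)`. -/
def mixture {K : ℕ} (φ : ℝ → H) (B : Z → EuclideanSpace ℝ (Fin K)) (ϑ : Fin K → ℝ) : Z → H :=
  fun z => ∑ k, B z k • normFeature φ (ϑ k)

/-- The objective `‖Y - B Φ(ϑ)‖²_{L²(ν, H)} / (2 ν(Z)) + κ ∑ₖ ‖Bₖ‖_{L^p(ν)}`. -/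
def objective {K : ℕ} (φ : ℝ → H) (ν : Measure Z) (p : ℝ≥0∞) (κ : ℝ) (Y : Z → H)
    (B : Z → EuclideanSpace ℝ (Fin K)) (ϑ : Fin K → ℝ) : ℝ :=
  1 / (2 * ν.real Set.univ) * normL 2 ν (Y - mixture φ B ϑ) ^ 2
    + κ * ∑ k, normL p ν (fun z => B z k)

/-- `(B, ϑ)` minimizes the objective over `L²(ν, ℝ^K) × ΘT^K`. -/
structure IsEstimator {K : ℕ} (φ : ℝ → H) (ΘT : Set ℝ) (ν : Measure Z) (p : ℝ≥0∞) (κ : ℝ)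
    (Y : Z → H) (B : Z → EuclideanSpace ℝ (Fin K)) (ϑ : Fin K → ℝ) : Prop where
  memLp : MemLp B 2 ν
  mem : ∀ k, ϑ k ∈ ΘT
  le : ∀ (B' : Z → EuclideanSpace ℝ (Fin K)) (ϑ' : Fin K → ℝ), MemLp B' 2 ν →
    (∀ k, ϑ' k ∈ ΘT) → objective φ ν p κ Y B ϑ ≤ objective φ ν p κ Y B' ϑ'

/-- The set `{k | ‖Bₖ‖_{L²(ν)} ≠ 0}` of the active indices. -/
def activeSet {K : ℕ} (ν : Measure Z) (B : Z → EuclideanSpace ℝ (Fin K)) : Set (Fin K) :=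
  {k | normL 2 ν (fun z => B z k) ≠ 0}

/-! ### Certificates -/

/-- The closed ball `{θ' ∈ ΘT | 𝔡_T(θ, θ') ≤ r}` for the metric of the dictionary. -/
def dictBall (Θ ΘT : Set ℝ) (φ : ℝ → H) (θ r : ℝ) : Set ℝ :=
  {θ' ∈ ΘT | riemDist Θ (dictKernel φ) θ θ' ≤ r}

/-- `Q` is a subset of `ΘT` with exactly `s ≥ 1` elements, at mutual distances larger than `2r`. -/
structure IsSeparated (Θ ΘT : Set ℝ) (φ : ℝ → H) (s : ℕ) (r : ℝ) (Q : Set ℝ) : Prop where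
  subset : Q ⊆ ΘT
  one_le : 1 ≤ s
  ncard : Q.ncard = s
  separated : ∀ θ ∈ Q, ∀ θ' ∈ Q, θ ≠ θ' → 2 * r < riemDist Θ (dictKernel φ) θ θ'

/-- Existence of interpolating certificates for `Q`, with the constants `CN`, `CN'`, `CF`, `CB`. -/
structure InterpolatingCertificate (Θ ΘT : Set ℝ) (φ : ℝ → H) (ν : Measure Z) (p q : ℝ≥0∞)
    (s : ℕ) (r : ℝ) (Q : Set ℝ) (CN CN' CF CB : ℝ) : Prop where
  separated : IsSeparated Θ ΘT φ s r Q
  certificate : ∀ V : Z → ℝ → ℝ,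
    (∀ θs ∈ Q, Measurable (fun z => V z θs) ∧ normL q ν (fun z => V z θs) = 1) →
    ∃ P : Z → H, MemLp P q ν ∧
      (∀ θs ∈ Q, ∀ θ ∈ dictBall Θ ΘT φ θs r,
        normL q ν (fun z => ⟪normFeature φ θ, P z⟫) ≤
          1 - CN * riemDist Θ (dictKernel φ) θs θ ^ 2) ∧
      (∀ θs ∈ Q, ∀ θ ∈ dictBall Θ ΘT φ θs r,
        normL q ν (fun z => ⟪normFeature φ θ, P z⟫ - V z θs) ≤
          CN' * riemDist Θ (dictKernel φ) θs θ ^ 2) ∧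
      (∀ θ ∈ ΘT, (∀ θs ∈ Q, θ ∉ dictBall Θ ΘT φ θs r) →
        normL q ν (fun z => ⟪normFeature φ θ, P z⟫) ≤ 1 - CF) ∧
      normL 2 ν P ≤
        CB * √s * ν.real Set.univ ^ (1 / (2 * p.toReal) - 1 / (2 * q.toReal))

/-- Existence of interpolating derivative certificates for `Q`, with the constants `cN`, `cF`,
`cB`. -/
structure DerivativeCertificate (Θ ΘT : Set ℝ) (φ : ℝ → H) (ν : Measure Z) (p q : ℝ≥0∞)
    (s : ℕ) (r : ℝ) (Q : Set ℝ) (cN cF cB : ℝ) : Prop where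
  separated : IsSeparated Θ ΘT φ s r Q
  certificate : ∀ V : Z → ℝ → ℝ,
    (∀ θs ∈ Q, Measurable (fun z => V z θs) ∧ normL q ν (fun z => V z θs) = 1) →
    ∃ P : Z → H, MemLp P q ν ∧
      (∀ θs ∈ Q, ∀ θ ∈ dictBall Θ ΘT φ θs r,
        normL q ν (fun z => ⟪normFeature φ θ, P z⟫
            - V z θs * Real.sign (θ - θs) * riemDist Θ (dictKernel φ) θ θs) ≤
          cN * riemDist Θ (dictKernel φ) θs θ ^ 2) ∧
      (∀ θ ∈ ΘT, (∀ θs ∈ Q, θ ∉ dictBall Θ ΘT φ θs r) →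
        normL q ν (fun z => ⟪normFeature φ θ, P z⟫) ≤ cF) ∧
      normL 2 ν P ≤
        cB * √s * ν.real Set.univ ^ (1 / (2 * p.toReal) - 1 / (2 * q.toReal))

/-! ### The noise -/

/-- The `W(z)`, `z ∈ Z`, are independent copies of one centered Gaussian noise on `H`, of variance
at most `σ² Δ ‖f‖²` in the direction `f`. The law of `W(z)` is that of the process
`(⟨f, W(z)⟩, f ∈ H)`, so no separability of `H` is needed. -/
structure AdmissibleNoise {Ω : Type*} [MeasurableSpace Ω] (P : Measure Ω) (W : Ω → Z → H)
    (σ Δ : ℝ) : Prop where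
  indep : iIndepFun (fun (z : Z) (ω : Ω) (f : H) => ⟪f, W ω z⟫) P
  ident : ∀ z z' : Z, IdentDistrib (fun (ω : Ω) (f : H) => ⟪f, W ω z⟫)
    (fun (ω : Ω) (f : H) => ⟪f, W ω z'⟫) P P
  gaussian : ∀ (z : Z) (f : H), HasGaussianLaw (fun ω => ⟪f, W ω z⟫) P
  centered : ∀ (z : Z) (f : H), ∫ ω, ⟪f, W ω z⟫ ∂P = 0
  variance_le : ∀ (z : Z) (f : H), variance (fun ω => ⟪f, W ω z⟫) P ≤ σ ^ 2 * Δ * ‖f‖ ^ 2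

end MixtureLasso

end

/-! The argument splits into a deterministic inequality, valid whenever the noise is small, and a
tail bound for that event. Since `ν` is a finite sum of Dirac masses, `f ↦ (√(a z) • f z)` turns
`L²(ν, E)` into a Euclidean sum, and everything is phrased with inner products there.

Deterministic part (`prediction_error_le`, `norm_mixture_sub_le`). Let `D` be the prediction error.
Optimality gives `D²/2 ≤` noise pairing `+ ν(Z) κ (Σ‖B⋆‖ - Σ‖B̂‖)`. Attach each estimated parameter
lying in a ball around an active true one to such a centre, at signed arc length `x`, and expand the
noise to second order there. If `M` bounds the noise and its first two covariant derivatives on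
`Θ_T`, the noise pairing is at most `M (I0 + I1 + I2 + I3)`: `I0` is the mismatch of grouped
coefficients, `I1` their first moments in `x`, `I2` the second moment, `I3` the mass far from the
true parameters. Certificates with suitable signs bound `I0` and `I1` by `√s D` plus multiples of
`I2`, `I3`. The interpolating certificate with the signs of `B⋆` bounds `I2 + I3` by `Σ‖B̂‖ - Σ‖B⋆‖`
plus a multiple of `√s D`. If `M` is a small multiple of `ν(Z) κ`, the terms in `I2 + I3` are
absorbed and `D² ≲ √s D ν(Z) κ` remains.

Probabilistic part. At a fixed feature the squared noise norm is a weighted sum of `n` squares of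
independent Gaussians; an exponential moment gives the tail `√2 ^ n * exp (-β t²)`
(`measure_lt_norm_weightedVec_le`). By `norm_featDeriv_le`, features of orders 0, 1, 2 are Lipschitz
in arc length, so increments have the same tail at their own scale. Dyadic chaining
(`measure_exists_lt_norm_le_of_increments`) then costs only a factor `2 (L + 1)`, where `L` is the
length of `Θ_T`. The bound on `κ` makes the exponent at least `2n + log τ`, which beats `√2 ^ n`
with room to spare. -/

namespace MixtureLasso

/-! ### `L²` of a finite weighted set -/

section WeightedSpace

variable {Z : Type*} {E : Type*} [NormedAddCommGroup E] [InnerProductSpace ℝ E]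

/-- The isometry from `L²(∑ a_z δ_z, E)` to the Euclidean sum of copies of `E`. -/
noncomputable def weightedVec (a : Z → ℝ) : (Z → E) →ₗ[ℝ] PiLp 2 (fun _ : Z => E) where
  toFun f := WithLp.toLp 2 (fun z => √(a z) • f z)
  map_add' f g := by ext z; simp
  map_smul' c f := by ext z; exact smul_comm _ _ _

@[simp]
theorem weightedVec_apply (a : Z → ℝ) (f : Z → E) (z : Z) :
    weightedVec a f z = √(a z) • f z := rfl

variable [Fintype Z]

theorem norm_weightedVec_sq {a : Z → ℝ} (ha : ∀ z, 0 ≤ a z) (f : Z → E) :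
    ‖weightedVec a f‖ ^ 2 = ∑ z, a z * ‖f z‖ ^ 2 := by
  rw [PiLp.norm_sq_eq_of_L2]
  refine Finset.sum_congr rfl fun z _ => ?_
  rw [weightedVec_apply, norm_smul, mul_pow, Real.norm_eq_abs, sq_abs, Real.sq_sqrt (ha z)]

theorem inner_weightedVec {a : Z → ℝ} (ha : ∀ z, 0 ≤ a z) (f g : Z → E) :
    ⟪weightedVec a f, weightedVec a g⟫ = ∑ z, a z * ⟪f z, g z⟫ := by
  rw [PiLp.inner_apply]
  refine Finset.sum_congr rfl fun z _ => ?_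
  rw [weightedVec_apply, weightedVec_apply, inner_smul_left, inner_smul_right, ← mul_assoc]
  simp [Real.mul_self_sqrt (ha z)]

/-- Reduces the pairing of a mixture with an `H`-valued certificate to scalar pairings with the
coefficients. -/
theorem inner_weightedVec_smul {a : Z → ℝ} (ha : ∀ z, 0 ≤ a z) (b : Z → ℝ) (x : E) (p : Z → E) :
    ⟪weightedVec a (fun z => b z • x), weightedVec a p⟫ =
      ⟪weightedVec a b, weightedVec a (fun z => ⟪x, p z⟫)⟫ := by
  rw [inner_weightedVec ha, inner_weightedVec ha]
  refine Finset.sum_congr rfl fun z _ => ?_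
  simp [inner_smul_left, mul_comm]

/-- Integration against a Dirac mass is evaluation for every function once singletons are
measurable, so `f` needs no measurability. -/
theorem normL_two_eq [MeasurableSpace Z] [MeasurableSingletonClass Z] {a : Z → ℝ}
    (ha : ∀ z, 0 ≤ a z) {ν : Measure Z}
    (hν : ν = ∑ z, ENNReal.ofReal (a z) • Measure.dirac z) (f : Z → E) :
    normL 2 ν f = ‖weightedVec a f‖ := by
  have h : eLpNorm f 2 ν = ENNReal.ofReal (∑ z, a z * ‖f z‖ ^ 2) ^ (1 / 2 : ℝ) := by
    rw [eLpNorm_eq_lintegral_rpow_enorm_toReal (by norm_num) (by norm_num), hν,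
      lintegral_finsetSum_measure, ENNReal.ofReal_sum_of_nonneg
        (fun z _ => mul_nonneg (ha z) (sq_nonneg _))]
    congr 1
    refine Finset.sum_congr rfl fun z _ => ?_
    rw [lintegral_smul_measure, lintegral_dirac, ENNReal.ofReal_mul (ha z), smul_eq_mul,
      ENNReal.ofReal_pow (norm_nonneg _), ofReal_norm]
    simp
  rw [normL, h, ← norm_weightedVec_sq ha, ← ENNReal.toReal_rpow,
    ENNReal.toReal_ofReal (sq_nonneg _), ← Real.sqrt_eq_rpow, Real.sqrt_sq (norm_nonneg _)]

theorem norm_weightedVec_const {a : Z → ℝ} (ha : ∀ z, 0 ≤ a z) (c : E) :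
    ‖weightedVec a (fun _ => c)‖ = √(∑ z, a z) * ‖c‖ := by
  rw [← sq_eq_sq₀ (norm_nonneg _) (by positivity), norm_weightedVec_sq ha, mul_pow,
    Real.sq_sqrt (Finset.sum_nonneg fun z _ => ha z), Finset.sum_mul]

theorem real_univ_sum_smul_dirac [MeasurableSpace Z] {a : Z → ℝ}
    (ha : ∀ z, 0 ≤ a z) {ν : Measure Z}
    (hν : ν = ∑ z, ENNReal.ofReal (a z) • Measure.dirac z) :
    ν.real Set.univ = ∑ z, a z := by
  rw [Measure.real, hν, Measure.finsetSum_apply]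
  simp only [Measure.smul_apply, measure_univ, smul_eq_mul, mul_one]
  rw [ENNReal.toReal_sum (by simp)]
  exact Finset.sum_congr rfl fun z _ => ENNReal.toReal_ofReal (ha z)

end WeightedSpace

/-! ### The deterministic prediction bound -/

section Deterministic

variable {E ι : Type*} [NormedAddCommGroup E] [InnerProductSpace ℝ E]

/-- Normalize `u k`, with the default `e` when `u k = 0`. The submodule matters because a sign
pattern must come from a function on `Z`: where `a z = 0`, weighted vectors have zero coordinate. -/
theorem exists_dual_family (p : Submodule ℝ E) {u : ι → E} (hu : ∀ k, u k ∈ p) {e : E}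
    (hep : e ∈ p) (he : ‖e‖ = 1) :
    ∃ v : ι → E, (∀ k, v k ∈ p) ∧ (∀ k, ‖v k‖ = 1) ∧ ∀ k, ⟪u k, v k⟫ = ‖u k‖ := by
  have h : ∀ k, ∃ w ∈ p, ‖w‖ = 1 ∧ ⟪u k, w⟫ = ‖u k‖ := fun k => by
    by_cases hk : u k = 0
    · exact ⟨e, hep, he, by simp [hk]⟩
    · have hk' : ‖u k‖ ≠ 0 := norm_ne_zero_iff.2 hk
      refine ⟨‖u k‖⁻¹ • u k, p.smul_mem _ (hu k),
        by rw [norm_smul, norm_inv, norm_norm, inv_mul_cancel₀ hk'], ?_⟩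
      rw [inner_smul_right, real_inner_self_eq_norm_sq]
      field_simp
  choose w hwp hw using h
  exact ⟨w, hwp, fun k => (hw k).1, fun k => (hw k).2⟩

variable [DecidableEq ι] {S N : Finset ι} {c : ι → ι} {x : ι → ℝ} {b bs : ι → E}

theorem sum_fiber_inner (hc : ∀ l ∈ N, c l ∈ S) (v : ι → E) :
    ∑ k ∈ S, ⟪∑ l ∈ N with c l = k, b l, v k⟫ = ∑ l ∈ N, ⟪b l, v (c l)⟫ := by
  rw [← Finset.sum_fiberwise_of_maps_to hc]
  refine Finset.sum_congr rfl fun k _ => ?_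
  rw [sum_inner]
  exact Finset.sum_congr rfl fun l hl => by rw [(Finset.mem_filter.1 hl).2]

theorem sum_fiber_smul_inner (hc : ∀ l ∈ N, c l ∈ S) (v : ι → E) :
    ∑ k ∈ S, ⟪∑ l ∈ N with c l = k, x l • b l, v k⟫ = ∑ l ∈ N, ⟪b l, x l • v (c l)⟫ := by
  rw [sum_fiber_inner hc (b := fun l => x l • b l)]
  simp [inner_smul_left, inner_smul_right]

variable [Fintype ι]

/-- The pairing of a family `b` with `p`, when `p` is close to `q` on `N` and bounded off `N`. -/
theorem abs_sum_inner_sub_le {p q : ι → E} {C F : ℝ}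
    (hN : ∀ l ∈ N, ‖p l - q l‖ ≤ C * x l ^ 2) (hF : ∀ l ∉ N, ‖p l‖ ≤ F) :
    |∑ l, ⟪b l, p l⟫ - ∑ l ∈ N, ⟪b l, q l⟫| ≤
      C * ∑ l ∈ N, ‖b l‖ * x l ^ 2 + F * ∑ l ∈ Nᶜ, ‖b l‖ := by
  have e : ∑ l, ⟪b l, p l⟫ - ∑ l ∈ N, ⟪b l, q l⟫ =
      ∑ l ∈ N, ⟪b l, p l - q l⟫ + ∑ l ∈ Nᶜ, ⟪b l, p l⟫ := by
    rw [← Finset.sum_add_sum_compl N]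
    simp only [inner_sub_right, Finset.sum_sub_distrib]
    ring
  rw [e, Finset.mul_sum, Finset.mul_sum]
  refine (abs_add_le _ _).trans (add_le_add ?_ ?_)
  · refine (Finset.abs_sum_le_sum_abs _ _).trans (Finset.sum_le_sum fun l hl => ?_)
    refine (abs_real_inner_le_norm _ _).trans ?_
    nlinarith [hN l hl, norm_nonneg (b l)]
  · refine (Finset.abs_sum_le_sum_abs _ _).trans (Finset.sum_le_sum fun l hl => ?_)
    refine (abs_real_inner_le_norm _ _).trans ?_
    nlinarith [hF l (Finset.mem_compl.1 hl), norm_nonneg (b l)]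

/-- The arithmetic that turns the certificate inequalities and the optimality of the estimator into
a bound for the prediction error `D`. -/
theorem error_le_of_certificate_bounds {CN CN' CF CB cN cF cB m D R κ M I0 I1 I2 I3 n0 n1 X : ℝ}
    (hm : 0 < m) (hmN : m ≤ CN) (hmF : m ≤ CF) (hCN' : 0 < CN') (hCB : 0 < CB) (hcN : 0 < cN)
    (hcF : 0 < cF) (hcB : 0 < cB) (hD : 0 ≤ D) (hR : 0 ≤ R) (hκ : 0 ≤ κ)
    (hI2 : 0 ≤ I2) (hI3 : 0 ≤ I3) (hM0 : 0 ≤ M)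
    (hM : M ≤ m / (2 * (2 + CN' + cN + cF)) * κ)
    (h0 : I0 ≤ CB * R * D + CN' * I2 + I3)
    (h1 : I1 ≤ cB * R * D + cN * I2 + cF * I3)
    (h2 : CN * I2 + CF * I3 ≤ n1 - n0 + CB * R * D)
    (hX : X ≤ M * (I0 + I1 + I2 + I3))
    (hn : n0 - n1 ≤ I0)
    (hopt : D ^ 2 / 2 ≤ X + κ * (n0 - n1)) :
    D ≤ 2 * ((m * (CB + cB) + CB) * (1 + (m + 2 * CN' + 2) / m)) * R * κ := by
  set B : ℝ := 2 + CN' + cN + cF with hB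
  have hBpos : 0 < B := by positivity
  set A : ℝ := CB + cB with hA
  have hApos : 0 < A := by positivity
  have hsum : I0 + I1 + I2 + I3 ≤ A * (R * D) + B * (I2 + I3) := by
    rw [hB, hA]
    linarith [mul_nonneg hCN'.le hI3, mul_nonneg hcN.le hI3, mul_nonneg hcF.le hI2]
  obtain ⟨u, hu⟩ : ∃ u, u = κ * (R * D) := ⟨_, rfl⟩
  obtain ⟨v, hv⟩ : ∃ v, v = κ * (I2 + I3) := ⟨_, rfl⟩
  have hu0 : 0 ≤ u := by rw [hu]; positivity
  have hX2 : X ≤ m * A * u + m / 2 * v := by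
    have hpos : 0 ≤ A * (R * D) + B * (I2 + I3) := by positivity
    calc X ≤ M * (A * (R * D) + B * (I2 + I3)) := hX.trans (mul_le_mul_of_nonneg_left hsum hM0)
      _ ≤ m / (2 * B) * κ * (A * (R * D) + B * (I2 + I3)) := mul_le_mul_of_nonneg_right hM hpos
      _ = m * A * u * (1 / (2 * B)) + m / 2 * v := by rw [hu, hv]; field_simp
      _ ≤ m * A * u * 1 + m / 2 * v := by
        have : 1 / (2 * B) ≤ 1 := by rw [div_le_one (by positivity)]; linarith
        gcongr
      _ = m * A * u + m / 2 * v := by ring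
  have hmJ : m * v ≤ κ * (n1 - n0) + CB * u := by
    have h3 : m * (I2 + I3) ≤ n1 - n0 + CB * R * D := by
      linarith [mul_le_mul_of_nonneg_right hmN hI2, mul_le_mul_of_nonneg_right hmF hI3]
    have h4 := mul_le_mul_of_nonneg_left h3 hκ
    rw [hu, hv]
    linarith
  -- Sum of `hX2`, `hmJ` and optimality, with `D²` dropped: the noise uses up only half of the `m *
  -- v` supplied by the certificate.
  have hv1 : m * v ≤ 2 * (m * A + CB) * u := by linarith [sq_nonneg D]
  have hv2 : v ≤ 2 * (m * A + CB) * u / m := by rw [le_div_iff₀ hm]; linarith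
  have hI0 : κ * (n0 - n1) ≤ CB * u + (CN' + 1) * v := by
    have h3 : n0 - n1 ≤ CB * R * D + (CN' + 1) * (I2 + I3) := by
      linarith [mul_nonneg hCN'.le hI3]
    have h4 := mul_le_mul_of_nonneg_left h3 hκ
    rw [hu, hv]
    linarith
  -- Second use of optimality, now keeping `D²`, with `n0 - n1` bounded through `I0` and `v` through
  -- `hv2`.
  have hfin : D ^ 2 / 2 ≤ (m * A + CB) * (1 + (m + 2 * CN' + 2) / m) * u := by
    have h3 : (m / 2 + CN' + 1) * v ≤ (m / 2 + CN' + 1) * (2 * (m * A + CB) * u / m) :=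
      mul_le_mul_of_nonneg_left hv2 (by positivity)
    calc D ^ 2 / 2 ≤ (m * A + CB) * u + (m / 2 + CN' + 1) * v := by linarith
      _ ≤ (m * A + CB) * u + (m / 2 + CN' + 1) * (2 * (m * A + CB) * u / m) := by linarith
      _ = (m * A + CB) * (1 + (m + 2 * CN' + 2) / m) * u := by field_simp
  rcases hD.eq_or_lt with h | h
  · rw [← h]; positivity
  · refine le_of_mul_le_mul_left ?_ h
    rw [hu] at hfin
    linarith

/-- The deterministic prediction bound. The index `l ∈ N` is close to the active index `c l`, at
signed distance `x l`; `b` and `bs` are the estimated and the true coefficients, `D` is the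
prediction error, `w`, `ws`, `ws'` are the values of the noise at the estimated parameters, and of
the noise and its derivative at the true ones. -/
theorem prediction_error_le {CN CN' CF CB cN cF cB m D R κ M : ℝ} {w ws ws' : ι → E} {e : E}
    {V : Submodule ℝ E} (hb : ∀ l, b l ∈ V) (hbs : ∀ k, bs k ∈ V) (heV : e ∈ V) (he : ‖e‖ = 1)
    (hc : ∀ l ∈ N, c l ∈ S)
    (hm : 0 < m) (hmN : m ≤ CN) (hmF : m ≤ CF) (hCN' : 0 < CN') (hCB : 0 < CB)
    (hcN : 0 < cN) (hcF : 0 < cF) (hcB : 0 < cB) (hD : 0 ≤ D) (hR : 0 ≤ R) (hκ : 0 ≤ κ)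
    (hM0 : 0 ≤ M) (hM : M ≤ m / (2 * (2 + CN' + cN + cF)) * κ)
    (hP : ∀ v : ι → E, (∀ k, v k ∈ V) → (∀ k, ‖v k‖ = 1) → ∃ p : ι → E,
      (∀ l ∈ N, ‖p l‖ ≤ 1 - CN * x l ^ 2) ∧ (∀ l ∈ N, ‖p l - v (c l)‖ ≤ CN' * x l ^ 2) ∧
      (∀ l ∉ N, ‖p l‖ ≤ 1 - CF) ∧
      |∑ l, ⟪b l, p l⟫ - ∑ k ∈ S, ⟪bs k, v k⟫| ≤ CB * R * D)
    (hQ : ∀ v : ι → E, (∀ k, v k ∈ V) → (∀ k, ‖v k‖ = 1) → ∃ q : ι → E,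
      (∀ l ∈ N, ‖q l - x l • v (c l)‖ ≤ cN * x l ^ 2) ∧ (∀ l ∉ N, ‖q l‖ ≤ cF) ∧
      |∑ l, ⟪b l, q l⟫| ≤ cB * R * D)
    (hws : ∀ k ∈ S, ‖ws k‖ ≤ M) (hws' : ∀ k ∈ S, ‖ws' k‖ ≤ M)
    (hwN : ∀ l ∈ N, ‖w l - (ws (c l) + x l • ws' (c l))‖ ≤ M * x l ^ 2)
    (hwF : ∀ l ∉ N, ‖w l‖ ≤ M)
    (hopt : D ^ 2 / 2 ≤ (∑ l, ⟪b l, w l⟫ - ∑ k ∈ S, ⟪bs k, ws k⟫) +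
      κ * (∑ k ∈ S, ‖bs k‖ - ∑ l, ‖b l‖)) :
    D ≤ 2 * ((m * (CB + cB) + CB) * (1 + (m + 2 * CN' + 2) / m)) * R * κ := by
  have hI2 : 0 ≤ ∑ l ∈ N, ‖b l‖ * x l ^ 2 := Finset.sum_nonneg fun l _ => by positivity
  have hI3 : 0 ≤ ∑ l ∈ Nᶜ, ‖b l‖ := Finset.sum_nonneg fun l _ => by positivity
  refine error_le_of_certificate_bounds (M := M)
    (I0 := ∑ k ∈ S, ‖bs k - ∑ l ∈ N with c l = k, b l‖)
    (I1 := ∑ k ∈ S, ‖∑ l ∈ N with c l = k, x l • b l‖)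
    (I2 := ∑ l ∈ N, ‖b l‖ * x l ^ 2) (I3 := ∑ l ∈ Nᶜ, ‖b l‖)
    hm hmN hmF hCN' hCB hcN hcF hcB hD hR hκ hI2 hI3 hM0 hM ?_ ?_ ?_ ?_ ?_ hopt
  -- Signs dual to the mismatches turn the sum of norms into a difference of pairings; off `N` the
  -- certificate is at most `1 - CF ≤ 1`, hence coefficient 1 for `I3`.
  · obtain ⟨v, hvV, hv, hv'⟩ := exists_dual_family V
      (u := fun k => bs k - ∑ l ∈ N with c l = k, b l)
      (fun k => V.sub_mem (hbs k) (V.sum_mem fun l _ => hb l)) heV he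
    obtain ⟨p, -, hpN, hpF, hp⟩ := hP v hvV hv
    have h1 := abs_sum_inner_sub_le (b := b) hpN hpF
    have h2 : ∑ k ∈ S, ‖bs k - ∑ l ∈ N with c l = k, b l‖ =
        ∑ k ∈ S, ⟪bs k, v k⟫ - ∑ l ∈ N, ⟪b l, v (c l)⟫ := by
      rw [← sum_fiber_inner hc, ← Finset.sum_sub_distrib]
      exact Finset.sum_congr rfl fun k _ => by rw [← hv', inner_sub_left]
    rw [h2]
    rw [abs_le] at h1 hp
    nlinarith [h1.1, h1.2, hp.1, hp.2]
  · obtain ⟨v, hvV, hv, hv'⟩ := exists_dual_family V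
      (u := fun k => ∑ l ∈ N with c l = k, x l • b l)
      (fun k => V.sum_mem fun l _ => V.smul_mem _ (hb l)) heV he
    obtain ⟨q, hqN, hqF, hq⟩ := hQ v hvV hv
    have h1 := abs_sum_inner_sub_le (b := b) hqN hqF
    have h2 : ∑ k ∈ S, ‖∑ l ∈ N with c l = k, x l • b l‖ = ∑ l ∈ N, ⟪b l, x l • v (c l)⟫ := by
      rw [← sum_fiber_smul_inner hc]
      exact Finset.sum_congr rfl fun k _ => (hv' k).symm
    rw [h2]
    rw [abs_le] at h1 hq
    linarith [h1.1, h1.2, hq.1, hq.2]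
  -- The same certificate with the signs of `bs`: its strict decay away from the true parameters
  -- yields the gain in `I2` and `I3`.
  · obtain ⟨v, hvV, hv, hv'⟩ := exists_dual_family V hbs heV he
    obtain ⟨p, hpN, -, hpF, hp⟩ := hP v hvV hv
    have h1 : ∑ l, ⟪b l, p l⟫ ≤
        ∑ l, ‖b l‖ - CN * ∑ l ∈ N, ‖b l‖ * x l ^ 2 - CF * ∑ l ∈ Nᶜ, ‖b l‖ := by
      rw [← Finset.sum_add_sum_compl N, ← Finset.sum_add_sum_compl N (fun l => ‖b l‖),
        Finset.mul_sum, Finset.mul_sum]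
      have h3 : ∑ l ∈ N, ⟪b l, p l⟫ ≤ ∑ l ∈ N, (‖b l‖ - CN * (‖b l‖ * x l ^ 2)) :=
        Finset.sum_le_sum fun l hl => (real_inner_le_norm _ _).trans <|
          (mul_le_mul_of_nonneg_left (hpN l hl) (norm_nonneg _)).trans_eq (by ring)
      have h4 : ∑ l ∈ Nᶜ, ⟪b l, p l⟫ ≤ ∑ l ∈ Nᶜ, (‖b l‖ - CF * ‖b l‖) :=
        Finset.sum_le_sum fun l hl => (real_inner_le_norm _ _).trans <|
          (mul_le_mul_of_nonneg_left (hpF l (Finset.mem_compl.1 hl)) (norm_nonneg _)).trans_eq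
            (by ring)
      rw [Finset.sum_sub_distrib] at h3 h4
      linarith
    have h2 : ∑ k ∈ S, ⟪bs k, v k⟫ = ∑ k ∈ S, ‖bs k‖ := Finset.sum_congr rfl fun k _ => hv' k
    rw [h2, abs_le] at hp
    linarith [hp.1, hp.2]
  · have h1 := abs_sum_inner_sub_le (b := b) hwN hwF
    have h2 : ∑ l ∈ N, ⟪b l, ws (c l) + x l • ws' (c l)⟫ =
        ∑ k ∈ S, ⟪∑ l ∈ N with c l = k, b l, ws k⟫ +
        ∑ k ∈ S, ⟪∑ l ∈ N with c l = k, x l • b l, ws' k⟫ := by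
      rw [sum_fiber_inner hc, sum_fiber_smul_inner hc, ← Finset.sum_add_distrib]
      simp only [inner_add_right]
    have h3 : ∑ k ∈ S, ⟪∑ l ∈ N with c l = k, b l, ws k⟫ - ∑ k ∈ S, ⟪bs k, ws k⟫ ≤
        M * ∑ k ∈ S, ‖bs k - ∑ l ∈ N with c l = k, b l‖ := by
      rw [← Finset.sum_sub_distrib, Finset.mul_sum]
      refine Finset.sum_le_sum fun k hk => ?_
      rw [← inner_sub_left, ← norm_sub_rev, mul_comm]
      exact (real_inner_le_norm _ _).trans
        (mul_le_mul_of_nonneg_left (hws k hk) (norm_nonneg _))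
    have h4 : ∑ k ∈ S, ⟪∑ l ∈ N with c l = k, x l • b l, ws' k⟫ ≤
        M * ∑ k ∈ S, ‖∑ l ∈ N with c l = k, x l • b l‖ := by
      rw [Finset.mul_sum]
      refine Finset.sum_le_sum fun k hk => ?_
      rw [mul_comm]
      exact (real_inner_le_norm _ _).trans
        (mul_le_mul_of_nonneg_left (hws' k hk) (norm_nonneg _))
    rw [h2, abs_le] at h1
    linarith [h1.2]
  · have h1 : ∑ l ∈ N, ‖b l‖ ≤ ∑ l, ‖b l‖ :=
      Finset.sum_le_sum_of_subset_of_nonneg (Finset.subset_univ N) fun _ _ _ => norm_nonneg _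
    have h2 : ∑ k ∈ S, ‖∑ l ∈ N with c l = k, b l‖ ≤ ∑ l ∈ N, ‖b l‖ := by
      rw [← Finset.sum_fiberwise_of_maps_to hc]
      exact Finset.sum_le_sum fun k _ => norm_sum_le _ _
    have h3 : ∑ k ∈ S, ‖bs k‖ ≤ ∑ k ∈ S, ‖bs k - ∑ l ∈ N with c l = k, b l‖ +
        ∑ k ∈ S, ‖∑ l ∈ N with c l = k, b l‖ := by
      rw [← Finset.sum_add_distrib]
      refine Finset.sum_le_sum fun k _ => ?_
      simpa using norm_add_le (bs k - ∑ l ∈ N with c l = k, b l) (∑ l ∈ N with c l = k, b l)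
    linarith

end Deterministic

/-! ### Tails of weighted sums of squares of Gaussian variables -/

section GaussianTail

-- For `c ≤ 1 / (4v)` the density of `N(0, v)` times `exp (c x²)` is at most `√2` times the density
-- of `N(0, 2v)`. The degenerate case `v = 0` is a point mass at 0.
open Real in
theorem lintegral_exp_sq_gaussianReal_le {v : NNReal} {c : ℝ} (hcv : 4 * v * c ≤ 1) :
    ∫⁻ x, ENNReal.ofReal (exp (c * x ^ 2)) ∂(gaussianReal 0 v) ≤ ENNReal.ofReal √2 := by
  by_cases hv : v = 0
  · subst hv
    rw [gaussianReal_zero_var, lintegral_dirac]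
    refine ENNReal.ofReal_le_ofReal ?_
    simp
  have hvpos : (0 : ℝ) < v := by positivity
  have h2v : (2 * v : NNReal) ≠ 0 := by positivity
  rw [gaussianReal_of_var_ne_zero _ hv, lintegral_withDensity_eq_lintegral_mul _
    (measurable_gaussianPDF _ _) (by fun_prop)]
  have key : ∀ x : ℝ, (gaussianPDF 0 v * fun x => ENNReal.ofReal (exp (c * x ^ 2))) x ≤
      ENNReal.ofReal √2 * gaussianPDF 0 (2 * v) x := fun x => by
    simp only [Pi.mul_apply, gaussianPDF]
    rw [← ENNReal.ofReal_mul (gaussianPDFReal_nonneg _ _ _), ← ENNReal.ofReal_mul (by positivity)]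
    refine ENNReal.ofReal_le_ofReal ?_
    simp only [gaussianPDFReal, sub_zero, NNReal.coe_mul, NNReal.coe_ofNat]
    have h1 : √(2 * π * (2 * v)) = √2 * √(2 * π * v) := by
      rw [← Real.sqrt_mul (by norm_num)]; congr 1; ring
    rw [h1, mul_inv, mul_assoc, ← exp_add, ← mul_assoc, ← mul_assoc,
      mul_inv_cancel₀ (by positivity), one_mul]
    refine mul_le_mul_of_nonneg_left (exp_le_exp.2 ?_) (by positivity)
    have h2 : c ≤ 1 / (4 * v) := by rw [le_div_iff₀ (by positivity)]; linarith
    have h3 : c * x ^ 2 ≤ 1 / (4 * v) * x ^ 2 := mul_le_mul_of_nonneg_right h2 (sq_nonneg x)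
    have h4 : -x ^ 2 / (2 * v) + 1 / (4 * v) * x ^ 2 = -x ^ 2 / (2 * (2 * v)) := by
      field_simp; ring
    linarith
  refine (lintegral_mono key).trans ?_
  rw [lintegral_const_mul _ (measurable_gaussianPDF _ _), lintegral_gaussianPDF_eq_one _ h2v,
    mul_one]

variable {Ω : Type*} [MeasurableSpace Ω] {P : Measure Ω}

theorem lintegral_exp_sq_le_of_hasGaussianLaw {X : Ω → ℝ} (hX : HasGaussianLaw X P)
    (h0 : ∫ ω, X ω ∂P = 0) {c : ℝ} (hcv : 4 * variance X P * c ≤ 1) :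
    ∫⁻ ω, ENNReal.ofReal (Real.exp (c * X ω ^ 2)) ∂P ≤ ENNReal.ofReal √2 := by
  have h := hX.map_eq_gaussianReal
  rw [h0] at h
  rw [← lintegral_map' (f := fun x => ENNReal.ofReal (Real.exp (c * x ^ 2))) (by fun_prop)
    hX.aemeasurable, h]
  refine lintegral_exp_sq_gaussianReal_le ?_
  rwa [Real.coe_toNNReal _ (variance_nonneg _ _)]

variable {Z : Type*} [Fintype Z]

/-- Exponential Markov inequality at `c = 1 / (4αV)`: this is the largest `c` for which every factor
`exp (c a_z X_z²)` is certain to have mean at most `√2` by the previous bound, and independence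
multiplies these means. -/
theorem measure_lt_norm_weightedVec_le {X : Z → Ω → ℝ} (hind : iIndepFun X P)
    (hX : ∀ z, HasGaussianLaw (X z) P) (h0 : ∀ z, ∫ ω, X z ω ∂P = 0) {a : Z → ℝ} {α V t : ℝ}
    (ha : ∀ z, 0 ≤ a z) (hα : ∀ z, a z ≤ α) (hαpos : 0 < α) (hV : 0 < V)
    (hvar : ∀ z, variance (X z) P ≤ V) (ht : 0 ≤ t) :
    P {ω | t < ‖weightedVec a (fun z => X z ω)‖} ≤
      ENNReal.ofReal (√2 ^ Fintype.card Z * Real.exp (-(t ^ 2 / (4 * α * V)))) := by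
  set c : ℝ := 1 / (4 * α * V) with hc
  have hcpos : 0 < c := by positivity
  -- Gaussian variables are only a.e. measurable, while the product formula for integrals is applied
  -- to measurable factors.
  set X' : Z → Ω → ℝ := fun z => (hX z).aemeasurable.mk with hX'
  have hXX' : ∀ z, X z =ᵐ[P] X' z := fun z => (hX z).aemeasurable.ae_eq_mk
  have hmeas : ∀ z, Measurable (X' z) := fun z => (hX z).aemeasurable.measurable_mk
  have hind' : iIndepFun (fun z ω => ENNReal.ofReal (Real.exp (c * a z * X' z ω ^ 2))) P :=
    (hind.congr hXX').comp (fun z x => ENNReal.ofReal (Real.exp (c * a z * x ^ 2)))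
      (fun z => by fun_prop)
  have hle : ∀ z, ∫⁻ ω, ENNReal.ofReal (Real.exp (c * a z * X' z ω ^ 2)) ∂P ≤
      ENNReal.ofReal √2 := fun z => by
    have e : ∫⁻ ω, ENNReal.ofReal (Real.exp (c * a z * X' z ω ^ 2)) ∂P =
        ∫⁻ ω, ENNReal.ofReal (Real.exp (c * a z * X z ω ^ 2)) ∂P :=
      lintegral_congr_ae ((hXX' z).mono fun ω hω => by simp only [hω])
    rw [e]
    refine lintegral_exp_sq_le_of_hasGaussianLaw (hX z) (h0 z) ?_
    calc 4 * variance (X z) P * (c * a z) ≤ 4 * V * (c * α) := by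
          have := hα z
          have := hvar z
          have := ha z
          gcongr
      _ = 1 := by rw [hc]; field_simp
  set f : Ω → ℝ≥0∞ := fun ω => ∏ z, ENNReal.ofReal (Real.exp (c * a z * X' z ω ^ 2)) with hf
  have hfm : Measurable f := by
    refine Finset.measurable_fun_prod _ fun z _ => ?_
    have := hmeas z
    fun_prop
  have hint : ∫⁻ ω, f ω ∂P ≤ ENNReal.ofReal √2 ^ Fintype.card Z := by
    rw [hf, lintegral_prod_eq_prod_lintegral_of_indepFun _ _ hind' fun z => by
      have := hmeas z
      fun_prop]
    calc _ ≤ ∏ _z : Z, ENNReal.ofReal √2 := Finset.prod_le_prod' fun z _ => hle z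
      _ = _ := by simp
  have hsub : {ω | t < ‖weightedVec a (fun z => X z ω)‖} ≤ᵐ[P]
      {ω | ENNReal.ofReal (Real.exp (c * t ^ 2)) ≤ f ω} := by
    filter_upwards [ae_all_iff.2 hXX'] with ω hω h
    change t < _ at h
    change ENNReal.ofReal (Real.exp (c * t ^ 2)) ≤ f ω
    have h1 : t ^ 2 ≤ ∑ z, a z * X' z ω ^ 2 := by
      have h2 := norm_weightedVec_sq ha (fun z => X z ω)
      have h3 : t ^ 2 ≤ ‖weightedVec a (fun z => X z ω)‖ ^ 2 := by gcongr
      rw [h2] at h3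
      simpa [hω] using h3
    rw [hf]
    simp only
    rw [← ENNReal.ofReal_prod_of_nonneg fun z _ => (Real.exp_pos _).le, ← Real.exp_sum]
    refine ENNReal.ofReal_le_ofReal (Real.exp_le_exp.2 ?_)
    calc c * t ^ 2 ≤ c * ∑ z, a z * X' z ω ^ 2 := by gcongr
      _ = _ := by rw [Finset.mul_sum]; simp [mul_assoc]
  refine (measure_mono_ae hsub).trans ?_
  refine (meas_ge_le_lintegral_div hfm.aemeasurable ?_ ENNReal.ofReal_ne_top).trans ?_
  · exact (ENNReal.ofReal_pos.2 (Real.exp_pos _)).ne'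
  · rw [ENNReal.ofReal_mul (by positivity), ENNReal.ofReal_pow (by positivity), Real.exp_neg,
      ENNReal.ofReal_inv_of_pos (Real.exp_pos _), div_eq_mul_inv]
    have e : t ^ 2 / (4 * α * V) = c * t ^ 2 := by rw [hc]; ring
    rw [e]
    gcongr

end GaussianTail

/-! ### Dyadic chaining -/

section Chaining

variable {Ω : Type*} [MeasurableSpace Ω] {P : Measure Ω} {E : Type*} [NormedAddCommGroup E]

/-- By Bernoulli `(9/4)^j ≥ 1 + j`, so each level gains a factor `1/4`; against the doubling of the
grid this leaves `(1/2)^j`. -/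
theorem exp_neg_chaining_le {y : ℝ} (hy0 : 0 ≤ y) (hy : Real.exp (-y) ≤ 1 / 4) {L : ℝ} (hL : 0 ≤ L)
    (j : ℕ) :
    (L * 2 ^ j + 1) * Real.exp (-(y * (9 / 4) ^ j)) ≤
      (L + 1) * Real.exp (-y) * (1 / 2) ^ j := by
  have h1 : (1 : ℝ) + j ≤ (9 / 4) ^ j := by
    have := one_add_mul_le_pow (a := (5 / 4 : ℝ)) (by norm_num) j
    norm_num at this
    have hj : (0 : ℝ) ≤ j := by positivity
    linarith
  have h2 : Real.exp (-(y * (9 / 4) ^ j)) ≤ Real.exp (-y) * (1 / 4) ^ j := by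
    calc Real.exp (-(y * (9 / 4) ^ j)) ≤ Real.exp (-y + j * (-y)) := by
          refine Real.exp_le_exp.2 ?_
          nlinarith
      _ = Real.exp (-y) * Real.exp (-y) ^ j := by rw [Real.exp_add, Real.exp_nat_mul]
      _ ≤ Real.exp (-y) * (1 / 4) ^ j := by gcongr
  have h3 : L * 2 ^ j + 1 ≤ (L + 1) * 2 ^ j := by
    have := one_le_pow₀ (M₀ := ℝ) one_le_two (n := j)
    linarith
  calc (L * 2 ^ j + 1) * Real.exp (-(y * (9 / 4) ^ j))
      ≤ ((L + 1) * 2 ^ j) * (Real.exp (-y) * (1 / 4) ^ j) := by gcongr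
    _ = (L + 1) * Real.exp (-y) * (2 ^ j * (1 / 4) ^ j) := by ring
    _ = (L + 1) * Real.exp (-y) * (1 / 2) ^ j := by rw [← mul_pow]; norm_num

/-- Approximate `t` by `⌊t 2^j⌋ / 2^j`. Level `j` is allowed `x (3/4)^j`, and these thresholds sum
to `4x`. Relative to the mesh `2^(-j)` the threshold is `x (3/2)^j`, so the exponent grows like
`(9/4)^j`. Continuity passes from the grid to all `t`, and only outer measures are used. -/
theorem measure_exists_lt_norm_le_of_increments {Y : ℝ → Ω → E} {L A β x : ℝ} (hL : 0 ≤ L)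
    (hA : 0 ≤ A) (hβ : 0 ≤ β) (hx : 0 ≤ x)
    (hcont : ∀ ω, ContinuousOn (fun t => Y t ω) (Set.Icc 0 L))
    (h0 : ∀ t ∈ Set.Icc 0 L, ∀ u, 0 ≤ u →
      P {ω | u < ‖Y t ω‖} ≤ ENNReal.ofReal (A * Real.exp (-(β * u ^ 2))))
    (h1 : ∀ s ∈ Set.Icc 0 L, ∀ t ∈ Set.Icc 0 L, ∀ d, 0 < d → |s - t| ≤ d → ∀ u, 0 ≤ u →
      P {ω | u < ‖Y s ω - Y t ω‖} ≤ ENNReal.ofReal (A * Real.exp (-(β * (u / d) ^ 2))))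
    (hy : Real.exp (-(β * x ^ 2)) ≤ 1 / 4) :
    P {ω | ∃ t ∈ Set.Icc 0 L, 4 * x < ‖Y t ω‖} ≤
      ENNReal.ofReal (2 * (L + 1) * A * Real.exp (-(β * x ^ 2))) := by
  set p : ℕ → ℕ → ℝ := fun j k => k / 2 ^ j with hp
  -- The parent of `k` at level `j` is `k / 2` at level `j - 1`; level 0 has no parent and
  -- contributes the value itself.
  set inc : ℕ → ℕ → Ω → E := fun j k ω =>
    if j = 0 then Y (p 0 k) ω else Y (p j k) ω - Y (p (j - 1) (k / 2)) ω with hinc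
  set R : ℕ → Finset ℕ := fun j => Finset.range (⌊L * 2 ^ j⌋₊ + 1) with hR
  set U : ℕ → Set Ω := fun j => ⋃ k ∈ R j, {ω | x * (3 / 4) ^ j < ‖inc j k ω‖} with hU
  have hmemR : ∀ j k, k ∈ R j ↔ (k : ℝ) ≤ L * 2 ^ j := fun j k => by
    rw [hR, Finset.mem_range, Nat.lt_succ_iff, Nat.le_floor_iff (by positivity)]
  have hpI : ∀ j k, k ∈ R j → p j k ∈ Set.Icc 0 L := fun j k hk =>
    ⟨by rw [hp]; positivity, by
      rw [hp]
      simp only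
      rw [div_le_iff₀ (by positivity)]
      exact (hmemR j k).1 hk⟩
  have hhalf : ∀ k : ℕ, ((k / 2 : ℕ) : ℝ) ≤ k / 2 ∧ (k : ℝ) / 2 ≤ ((k / 2 : ℕ) : ℝ) + 1 / 2 :=
    fun k => by
      refine ⟨Nat.cast_div_le, ?_⟩
      have : k ≤ 2 * (k / 2) + 1 := by omega
      have : (k : ℝ) ≤ 2 * ((k / 2 : ℕ) : ℝ) + 1 := by exact_mod_cast this
      linarith
  have hincP : ∀ j, ∀ k ∈ R j, P {ω | x * (3 / 4) ^ j < ‖inc j k ω‖} ≤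
      ENNReal.ofReal (A * Real.exp (-(β * x ^ 2 * (9 / 4) ^ j))) := by
    intro j k hk
    rcases j with _ | j
    · simpa [hinc] using h0 (p 0 k) (hpI 0 k hk) x hx
    · have hk2 : k / 2 ∈ R j := by
        rw [hmemR] at hk ⊢
        rw [pow_succ] at hk
        linarith [(hhalf k).1]
      have hd : |p (j + 1) k - p j (k / 2)| ≤ (1 / 2) ^ (j + 1) := by
        have e : p (j + 1) k - p j (k / 2) = ((k : ℝ) / 2 - ((k / 2 : ℕ) : ℝ)) / 2 ^ j := by
          rw [hp]
          simp only
          rw [pow_succ]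
          field_simp
        rw [e, abs_of_nonneg (div_nonneg (by linarith [(hhalf k).1]) (by positivity)),
          pow_succ, one_div, inv_pow, div_eq_mul_inv, mul_comm]
        refine mul_le_mul_of_nonneg_left ?_ (by positivity)
        linarith [(hhalf k).2]
      have := h1 _ (hpI _ k hk) _ (hpI _ _ hk2) _ (by positivity) hd (x * (3 / 4) ^ (j + 1))
        (by positivity)
      have e : β * (x * (3 / 4) ^ (j + 1) / (1 / 2) ^ (j + 1)) ^ 2 =
          β * x ^ 2 * (9 / 4) ^ (j + 1) := by
        rw [mul_div_assoc, ← div_pow, mul_pow, ← pow_mul, mul_comm (j + 1) 2, pow_mul]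
        norm_num
        ring
      rw [e] at this
      simpa [hinc] using this
  have hUP : ∀ j, P (U j) ≤
      ENNReal.ofReal ((L + 1) * Real.exp (-(β * x ^ 2)) * A * (1 / 2) ^ j) := by
    intro j
    calc P (U j) ≤ ∑ k ∈ R j, P {ω | x * (3 / 4) ^ j < ‖inc j k ω‖} :=
          measure_biUnion_finset_le _ _
      _ ≤ ∑ _k ∈ R j, ENNReal.ofReal (A * Real.exp (-(β * x ^ 2 * (9 / 4) ^ j))) :=
          Finset.sum_le_sum (hincP j)
      _ = ENNReal.ofReal ((⌊L * 2 ^ j⌋₊ + 1) *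
            (A * Real.exp (-(β * x ^ 2 * (9 / 4) ^ j)))) := by
          rw [Finset.sum_const, hR, Finset.card_range, nsmul_eq_mul,
            ENNReal.ofReal_mul (p := (⌊L * 2 ^ j⌋₊ : ℝ) + 1) (by positivity)]
          congr 1
          rw [← ENNReal.ofReal_natCast]
          push_cast
          rfl
      _ ≤ _ := by
          refine ENNReal.ofReal_le_ofReal ?_
          have h2 := exp_neg_chaining_le (y := β * x ^ 2) (by positivity) hy hL j
          have h3 : (⌊L * 2 ^ j⌋₊ : ℝ) ≤ L * 2 ^ j := Nat.floor_le (by positivity)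
          calc (⌊L * 2 ^ j⌋₊ + 1) * (A * Real.exp (-(β * x ^ 2 * (9 / 4) ^ j)))
              ≤ (L * 2 ^ j + 1) * (A * Real.exp (-(β * x ^ 2 * (9 / 4) ^ j))) := by gcongr
            _ = A * ((L * 2 ^ j + 1) * Real.exp (-(β * x ^ 2 * (9 / 4) ^ j))) := by ring
            _ ≤ A * ((L + 1) * Real.exp (-(β * x ^ 2)) * (1 / 2) ^ j) := by gcongr
            _ = _ := by ring
  have hsub : {ω | ∃ t ∈ Set.Icc 0 L, 4 * x < ‖Y t ω‖} ⊆ ⋃ j, U j := by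
    rintro ω ⟨t, ht, hlt⟩
    by_contra hω
    have hgood : ∀ j, ∀ k ∈ R j, ‖inc j k ω‖ ≤ x * (3 / 4) ^ j := by
      intro j k hk
      by_contra! hcon
      exact hω (Set.mem_iUnion.2 ⟨j, Set.mem_iUnion₂.2 ⟨k, hk, hcon⟩⟩)
    have hkR : ∀ j, ⌊t * 2 ^ j⌋₊ ∈ R j := fun j => by
      rw [hmemR]
      have := ht.1
      have := ht.2
      refine (Nat.floor_le (by positivity)).trans ?_
      gcongr
    -- The right side is the partial geometric sum of `x (3/4)^i` over `i ≤ j`.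
    have hbound : ∀ j, ‖Y (p j ⌊t * 2 ^ j⌋₊) ω‖ ≤ 4 * x * (1 - (3 / 4) ^ (j + 1)) := by
      intro j
      induction j with
      | zero =>
        have := hgood 0 _ (hkR 0)
        simp only [hinc, if_true, pow_zero, mul_one] at this ⊢
        norm_num at this ⊢
        linarith
      | succ j ih =>
        have h2 := hgood (j + 1) _ (hkR (j + 1))
        have e : ⌊t * 2 ^ (j + 1)⌋₊ / 2 = ⌊t * 2 ^ j⌋₊ := by
          rw [← Nat.floor_div_ofNat, pow_succ]
          congr 1
          ring
        simp only [hinc, Nat.succ_ne_zero, if_false, Nat.add_sub_cancel, e] at h2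
        have h3 := norm_sub_norm_le (Y (p (j + 1) ⌊t * 2 ^ (j + 1)⌋₊) ω) (Y (p j ⌊t * 2 ^ j⌋₊) ω)
        have e2 : 4 * x * (1 - (3 / 4) ^ (j + 1 + 1)) =
          4 * x * (1 - (3 / 4) ^ (j + 1)) + x * (3 / 4) ^ (j + 1) := by ring
        linarith
    have hlim : Filter.Tendsto (fun j => p j ⌊t * 2 ^ j⌋₊) Filter.atTop (nhds t) :=
      (tendsto_nat_floor_mul_div_atTop ht.1).comp
        (tendsto_pow_atTop_atTop_of_one_lt (r := (2 : ℝ)) one_lt_two)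
    have hlim2 : Filter.Tendsto (fun j => ‖Y (p j ⌊t * 2 ^ j⌋₊) ω‖) Filter.atTop
        (nhds ‖Y t ω‖) :=
      ((hcont ω t ht).tendsto.comp (tendsto_nhdsWithin_iff.2
        ⟨hlim, Filter.Eventually.of_forall fun j => hpI j _ (hkR j)⟩)).norm
    have : ‖Y t ω‖ ≤ 4 * x := le_of_tendsto' hlim2 fun j => (hbound j).trans (by
      have : 0 ≤ x * (3 / 4 : ℝ) ^ (j + 1) := by positivity
      linarith)
    linarith
  calc _ ≤ P (⋃ j, U j) := measure_mono hsub
    _ ≤ ∑' j, P (U j) := measure_iUnion_le _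
    _ ≤ ∑' j, ENNReal.ofReal ((L + 1) * Real.exp (-(β * x ^ 2)) * A * (1 / 2) ^ j) :=
      ENNReal.tsum_le_tsum hUP
    _ = ENNReal.ofReal (∑' j, (L + 1) * Real.exp (-(β * x ^ 2)) * A * (1 / 2) ^ j) :=
      (ENNReal.ofReal_tsum_of_nonneg (fun j => by positivity)
        (summable_geometric_two.mul_left _)).symm
    _ = _ := by
      rw [tsum_mul_left, tsum_geometric_two]
      congr 1
      ring

end Chaining

/-! ### Calculus in the arc length parameter -/

section ArcLength

variable {E : Type*} [NormedAddCommGroup E] [NormedSpace ℝ E]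

/-- Extending `ρ` by its end values makes it continuous on the line without changing the integrals
over subintervals. -/
theorem hasDerivWithinAt_integral_of_continuousOn {ρ : ℝ → ℝ} {x y : ℝ}
    (hρ : ContinuousOn ρ (Set.uIcc x y)) {t : ℝ} (ht : t ∈ Set.uIcc x y) :
    HasDerivWithinAt (fun u => ∫ s in x..u, ρ s) (ρ t) (Set.uIcc x y) t := by
  set ρ' : ℝ → ℝ := Set.IccExtend (inf_le_sup (a := x) (b := y))
    (Set.domRestrict (Set.Icc (x ⊓ y) (x ⊔ y)) ρ) with hρ'
  have hc : Continuous ρ' := Continuous.Icc_extend' (continuousOn_iff_continuous_domRestrict.1 hρ)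
  have heq : ∀ s ∈ Set.uIcc x y, ρ' s = ρ s := fun s hs => by
    rw [hρ', Set.IccExtend_of_mem _ _ hs]
    rfl
  have h := ((hc.integral_hasStrictDerivAt x t).hasDerivAt).hasDerivWithinAt (s := Set.uIcc x y)
  rw [heq t ht] at h
  have hint : ∀ u ∈ Set.uIcc x y, ∫ s in x..u, ρ s = ∫ s in x..u, ρ' s := fun u hu =>
    intervalIntegral.integral_congr fun s hs =>
      (heq s (Set.uIcc_subset_uIcc Set.left_mem_uIcc hu hs)).symm
  exact h.congr hint (hint t ht)

/-- Mean value inequality with the primitive `M ∫ ρ` as comparison function. -/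
theorem norm_sub_le_mul_integral {ρ : ℝ → ℝ} {X D : ℝ → E} {M a b : ℝ} (hab : a ≤ b)
    (hρ : ContinuousOn ρ (Set.Icc a b)) (hρ0 : ∀ t ∈ Set.Icc a b, 0 ≤ ρ t)
    (hX : ∀ t ∈ Set.Icc a b, HasDerivWithinAt X (ρ t • D t) (Set.Icc a b) t)
    (hD : ∀ t ∈ Set.Icc a b, ‖D t‖ ≤ M) :
    ‖X b - X a‖ ≤ M * ∫ t in a..b, ρ t := by
  rw [← Set.uIcc_of_le hab] at hρ
  have hG : ∀ t ∈ Set.Icc a b, HasDerivWithinAt (fun u => M * ∫ s in a..u, ρ s) (M * ρ t)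
      (Set.Icc a b) t := fun t ht => by
    have := hasDerivWithinAt_integral_of_continuousOn hρ (t := t) (by rwa [Set.uIcc_of_le hab])
    rw [Set.uIcc_of_le hab] at this
    exact this.const_mul M
  have hmem : ∀ t ∈ Set.Ico a b, Set.Icc a b ∈ nhdsWithin t (Set.Ici t) := fun t ht =>
    Filter.mem_of_superset (Icc_mem_nhdsGE ht.2) (Set.Icc_subset_Icc_left ht.1)
  refine image_norm_le_of_norm_deriv_right_le_deriv_boundary' (f := fun t => X t - X a)
    (f' := fun t => ρ t • D t) (B := fun u => M * ∫ s in a..u, ρ s) (B' := fun t => M * ρ t)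
    (a := a) (b := b) ?_ ?_ ?_ ?_ ?_ ?_ ⟨hab, le_rfl⟩
  · exact fun t ht => ((hX t ht).sub_const (X a)).continuousWithinAt
  · exact fun t ht => ((hX t ⟨ht.1, ht.2.le⟩).sub_const (X a)).mono_of_mem_nhdsWithin (hmem t ht)
  · simp
  · exact fun t ht => (hG t ht).continuousWithinAt
  · exact fun t ht => (hG t ⟨ht.1, ht.2.le⟩).mono_of_mem_nhdsWithin (hmem t ht)
  · intro t ht
    have h1 := hρ0 t ⟨ht.1, ht.2.le⟩
    rw [norm_smul, Real.norm_of_nonneg h1, mul_comm]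
    exact mul_le_mul_of_nonneg_right (hD t ⟨ht.1, ht.2.le⟩) h1

theorem norm_sub_le_mul_abs_integral {ρ : ℝ → ℝ} {X D : ℝ → E} {M x y : ℝ}
    (hρ : ContinuousOn ρ (Set.uIcc x y)) (hρ0 : ∀ t ∈ Set.uIcc x y, 0 ≤ ρ t)
    (hX : ∀ t ∈ Set.uIcc x y, HasDerivWithinAt X (ρ t • D t) (Set.uIcc x y) t)
    (hD : ∀ t ∈ Set.uIcc x y, ‖D t‖ ≤ M) :
    ‖X y - X x‖ ≤ M * |∫ t in x..y, ρ t| := by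
  rcases le_total x y with h | h
  · rw [Set.uIcc_of_le h] at *
    rw [abs_of_nonneg (intervalIntegral.integral_nonneg h hρ0)]
    exact norm_sub_le_mul_integral h hρ hρ0 hX hD
  · rw [Set.uIcc_of_ge h] at *
    rw [intervalIntegral.integral_symm, abs_neg,
      abs_of_nonneg (intervalIntegral.integral_nonneg h hρ0), norm_sub_rev]
    exact norm_sub_le_mul_integral h hρ hρ0 hX hD

/-- The mean value inequality twice: `D` varies by at most `M |∫ ρ|` on the segment, and `X t - (∫
ρ) • D x` has derivative `ρ t • (D t - D x)`. This gives `M` in place of `M / 2`, which is enough.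
-/
theorem norm_taylor_le_mul_integral_sq {ρ : ℝ → ℝ} {X D D' : ℝ → E} {M x y : ℝ} (hM : 0 ≤ M)
    (hρ : ContinuousOn ρ (Set.uIcc x y)) (hρ0 : ∀ t ∈ Set.uIcc x y, 0 ≤ ρ t)
    (hX : ∀ t ∈ Set.uIcc x y, HasDerivWithinAt X (ρ t • D t) (Set.uIcc x y) t)
    (hD : ∀ t ∈ Set.uIcc x y, HasDerivWithinAt D (ρ t • D' t) (Set.uIcc x y) t)
    (hD' : ∀ t ∈ Set.uIcc x y, ‖D' t‖ ≤ M) :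
    ‖X y - (X x + (∫ t in x..y, ρ t) • D x)‖ ≤ M * (∫ t in x..y, ρ t) ^ 2 := by
  have hmono : ∀ t ∈ Set.uIcc x y, |∫ s in x..t, ρ s| ≤ |∫ s in x..y, ρ s| := fun t ht => by
    refine intervalIntegral.abs_integral_mono_interval
      (Set.uIoc_subset_uIoc_of_uIcc_subset_uIcc (Set.uIcc_subset_uIcc Set.left_mem_uIcc ht)) ?_
      hρ.intervalIntegrable
    exact (ae_restrict_mem measurableSet_uIoc).mono fun s hs => hρ0 s (Set.uIoc_subset_uIcc hs)
  have hD1 : ∀ t ∈ Set.uIcc x y, ‖D t - D x‖ ≤ M * |∫ s in x..y, ρ s| := fun t ht => by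
    have hsub : Set.uIcc x t ⊆ Set.uIcc x y := Set.uIcc_subset_uIcc Set.left_mem_uIcc ht
    refine (norm_sub_le_mul_abs_integral (hρ.mono hsub) (fun s hs => hρ0 s (hsub hs))
      (fun s hs => (hD s (hsub hs)).mono hsub) (fun s hs => hD' s (hsub hs))).trans ?_
    exact mul_le_mul_of_nonneg_left (hmono t ht) hM
  have h := norm_sub_le_mul_abs_integral (X := fun t => X t - (∫ s in x..t, ρ s) • D x)
    (D := fun t => D t - D x) hρ hρ0 (fun t ht => by
      rw [smul_sub]
      exact (hX t ht).sub ((hasDerivWithinAt_integral_of_continuousOn hρ ht).smul_const (D x))) hD1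
  rw [mul_assoc, abs_mul_abs_self, ← sq] at h
  convert h using 2
  simp
  abel

end ArcLength

/-! ### Covariant derivatives of the features -/

section Features

variable {H : Type*} [NormedAddCommGroup H] [InnerProductSpace ℝ H]

/-- The square root of the metric of the dictionary. -/
noncomputable def dictSpeed (Θ : Set ℝ) (φ : ℝ → H) (θ : ℝ) : ℝ :=
  √(kernelMetric Θ (dictKernel φ) θ)

/-- The covariant derivative of order `i` of the normalized feature, that is, its derivative of
order `i` in the arc length parameter. -/
noncomputable def featDeriv (Θ : Set ℝ) (φ : ℝ → H) : ℕ → ℝ → H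
  | 0 => normFeature φ
  | i + 1 => fun θ => (dictSpeed Θ φ θ)⁻¹ • derivWithin (featDeriv Θ φ i) Θ θ

variable {Θ : Set ℝ} {φ : ℝ → H}

/-- `derivWithin` is zero by convention at points without unique differentials, which positivity of
the metric excludes. -/
theorem IsRegularDictionary.uniqueDiffOn (h : IsRegularDictionary Θ φ) : UniqueDiffOn ℝ Θ := by
  intro θ hθ
  by_contra hcon
  have := h.metric_pos θ hθ
  rw [derivWithin_zero_of_not_uniqueDiffWithinAt hcon] at this
  simp at this

theorem IsRegularDictionary.contDiffOn_normFeature (h : IsRegularDictionary Θ φ) :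
    ContDiffOn ℝ 3 (normFeature φ) Θ :=
  ((h.smooth.norm ℝ fun θ hθ => norm_pos_iff.1 (h.norm_pos θ hθ)).inv
    fun θ hθ => (h.norm_pos θ hθ).ne').smul h.smooth

theorem IsRegularDictionary.kernelMetric_eq (h : IsRegularDictionary Θ φ) {θ : ℝ} (hθ : θ ∈ Θ) :
    kernelMetric Θ (dictKernel φ) θ = ‖derivWithin (normFeature φ) Θ θ‖ ^ 2 := by
  have hd := (h.contDiffOn_normFeature.differentiableOn (by norm_num) θ hθ).hasDerivWithinAt
  have hu := h.uniqueDiffOn θ hθ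
  have h1 : ∀ x, partialY Θ (dictKernel φ) x θ =
      ⟪normFeature φ x, derivWithin (normFeature φ) Θ θ⟫ := fun x => by
    have := ((hasDerivWithinAt_const θ Θ (normFeature φ x)).inner ℝ hd).derivWithin hu
    simpa [partialY, dictKernel] using this
  have h2 := (hd.inner ℝ (hasDerivWithinAt_const θ Θ
    (derivWithin (normFeature φ) Θ θ))).derivWithin hu
  unfold kernelMetric partialX
  simp only [h1]
  rw [h2, inner_zero_right, zero_add, real_inner_self_eq_norm_sq]

theorem IsRegularDictionary.dictSpeed_eq (h : IsRegularDictionary Θ φ) {θ : ℝ} (hθ : θ ∈ Θ) :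
    dictSpeed Θ φ θ = ‖derivWithin (normFeature φ) Θ θ‖ := by
  rw [dictSpeed, h.kernelMetric_eq hθ, Real.sqrt_sq (norm_nonneg _)]

theorem IsRegularDictionary.dictSpeed_pos (h : IsRegularDictionary Θ φ) {θ : ℝ} (hθ : θ ∈ Θ) :
    0 < dictSpeed Θ φ θ := by
  rw [h.dictSpeed_eq hθ]
  refine lt_of_le_of_ne (norm_nonneg _) fun h0 => ?_
  have := h.metric_pos θ hθ
  rw [← h0] at this
  simp at this

theorem IsRegularDictionary.contDiffOn_dictSpeed (h : IsRegularDictionary Θ φ) :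
    ContDiffOn ℝ 2 (dictSpeed Θ φ) Θ := by
  have h1 : ContDiffOn ℝ 2 (derivWithin (normFeature φ) Θ) Θ :=
    h.contDiffOn_normFeature.derivWithin h.uniqueDiffOn (by norm_num)
  refine (h1.norm ℝ fun θ hθ h0 => ?_).congr fun θ hθ => h.dictSpeed_eq hθ
  have := h.metric_pos θ hθ
  rw [h0] at this
  simp at this

theorem IsRegularDictionary.contDiffOn_featDeriv (h : IsRegularDictionary Θ φ) (i j : ℕ)
    (hij : i + j = 3) : ContDiffOn ℝ j (featDeriv Θ φ i) Θ := by
  induction i generalizing j with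
  | zero =>
    obtain rfl : j = 3 := by omega
    exact h.contDiffOn_normFeature
  | succ i ih =>
    have h1 : ContDiffOn ℝ j (derivWithin (featDeriv Θ φ i) Θ) Θ :=
      (ih (j + 1) (by omega)).derivWithin h.uniqueDiffOn (by norm_cast)
    have h2 : ContDiffOn ℝ j (dictSpeed Θ φ) Θ :=
      h.contDiffOn_dictSpeed.of_le (by norm_cast; omega)
    exact (h2.inv fun θ hθ => (h.dictSpeed_pos hθ).ne').smul h1

theorem IsRegularDictionary.hasDerivWithinAt_featDeriv (h : IsRegularDictionary Θ φ) {i : ℕ}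
    (hi : i < 3) {θ : ℝ} (hθ : θ ∈ Θ) :
    HasDerivWithinAt (featDeriv Θ φ i) (dictSpeed Θ φ θ • featDeriv Θ φ (i + 1) θ) Θ θ := by
  have h1 := ((h.contDiffOn_featDeriv i (3 - i) (by omega)).differentiableOn
    (by norm_cast; omega) θ hθ).hasDerivWithinAt
  rwa [featDeriv, smul_inv_smul₀ (h.dictSpeed_pos hθ).ne']

/-- Dividing by the power of the speed in the recursion cancels the prefactor from the previous
order, so only the feature is differentiated and each step produces one more factor of the speed. -/
theorem IsRegularDictionary.covDeriv_eq (h : IsRegularDictionary Θ φ) {i j : ℕ} (hi : i ≤ 3)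
    (hj : j ≤ 3) {x y : ℝ} (hx : x ∈ Θ) (hy : y ∈ Θ) :
    covDeriv Θ (dictKernel φ) (dictKernel φ) i j x y =
      dictSpeed Θ φ x ^ i * dictSpeed Θ φ y ^ j * ⟪featDeriv Θ φ i x, featDeriv Θ φ j y⟫ := by
  induction i generalizing x y with
  | zero =>
    induction j generalizing x y with
    | zero => simp [covDeriv, dictKernel, featDeriv]
    | succ j ih =>
      have h1 : derivWithin (fun t => covDeriv Θ (dictKernel φ) (dictKernel φ) 0 j x t /
          dictSpeed Θ φ t ^ j) Θ y =
          derivWithin (fun t => ⟪featDeriv Θ φ 0 x, featDeriv Θ φ j t⟫) Θ y := by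
        have : ∀ t ∈ Θ, covDeriv Θ (dictKernel φ) (dictKernel φ) 0 j x t /
            dictSpeed Θ φ t ^ j = ⟪featDeriv Θ φ 0 x, featDeriv Θ φ j t⟫ := fun t ht => by
          have := h.dictSpeed_pos ht
          rw [ih (by omega) hx ht]
          field_simp
        exact derivWithin_congr this (this y hy)
      have h2 := ((hasDerivWithinAt_const y Θ (featDeriv Θ φ 0 x)).inner ℝ
        (h.hasDerivWithinAt_featDeriv (i := j) (by omega) hy)).derivWithin (h.uniqueDiffOn y hy)
      rw [covDeriv]
      change dictSpeed Θ φ y ^ j * derivWithin (fun t => covDeriv Θ (dictKernel φ) (dictKernel φ)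
        0 j x t / dictSpeed Θ φ t ^ j) Θ y = _
      rw [h1, h2, inner_zero_left, add_zero, inner_smul_right]
      ring
  | succ i ih =>
    have h1 : derivWithin (fun t => covDeriv Θ (dictKernel φ) (dictKernel φ) i j t y /
        dictSpeed Θ φ t ^ i) Θ x =
        derivWithin (fun t => dictSpeed Θ φ y ^ j *
          ⟪featDeriv Θ φ i t, featDeriv Θ φ j y⟫) Θ x := by
      have : ∀ t ∈ Θ, covDeriv Θ (dictKernel φ) (dictKernel φ) i j t y /
          dictSpeed Θ φ t ^ i = dictSpeed Θ φ y ^ j *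
            ⟪featDeriv Θ φ i t, featDeriv Θ φ j y⟫ := fun t ht => by
        have := h.dictSpeed_pos ht
        rw [ih (by omega) ht hy]
        field_simp
      exact derivWithin_congr this (this x hx)
    have h2 := (((h.hasDerivWithinAt_featDeriv (i := i) (by omega) hx).inner ℝ
      (hasDerivWithinAt_const x Θ (featDeriv Θ φ j y))).const_mul
        (dictSpeed Θ φ y ^ j)).derivWithin (h.uniqueDiffOn x hx)
    rw [covDeriv]
    change dictSpeed Θ φ x ^ i * derivWithin (fun t => covDeriv Θ (dictKernel φ) (dictKernel φ)
      i j t y / dictSpeed Θ φ t ^ i) Θ x = _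
    rw [h1, h2, inner_zero_right, zero_add, inner_smul_left]
    simp
    ring

theorem IsRegularDictionary.kernelDeriv_self (h : IsRegularDictionary Θ φ) {i : ℕ} (hi : i ≤ 3)
    {θ : ℝ} (hθ : θ ∈ Θ) :
    kernelDeriv Θ (dictKernel φ) i i θ θ = ‖featDeriv Θ φ i θ‖ ^ 2 := by
  have := h.dictSpeed_pos hθ
  rw [kernelDeriv, h.covDeriv_eq hi hi hθ hθ, real_inner_self_eq_norm_sq]
  change _ / (dictSpeed Θ φ θ ^ i * dictSpeed Θ φ θ ^ i) = _
  field_simp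

/-- A bound for the covariant derivatives of order at most `3` of the features of a dictionary whose
kernel is close to `K` on a subset of `S`. -/
noncomputable def featBound (Θ S : Set ℝ) (K : ℝ → ℝ → ℝ) : ℝ :=
  √(1 + |supDeriv Θ S K 0 0| + |supDeriv Θ S K 1 1| + 2 * |supDeriv Θ S K 2 2| + |supH Θ S K|)

theorem featBound_pos (Θ S : Set ℝ) (K : ℝ → ℝ → ℝ) : 0 < featBound Θ S K :=
  Real.sqrt_pos.2 (by positivity)

/-- Squared norms of feature derivatives are diagonal values of the kernel derivatives. Order 3 is
reached through `kernelH`; the second copy of `supDeriv Θ S K 2 2` in `featBound` pays for the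
distance between the kernels. -/
theorem norm_featDeriv_le {S T : Set ℝ} {K : ℝ → ℝ → ℝ} (h : IsRegularDictionary Θ φ)
    (hK : IsLimitKernel Θ S K) (hT : T ⊆ S)
    (hclose : KernelsClose Θ T (dictKernel φ) K (min (supDeriv Θ S K 2 2) (supH Θ S K)))
    {i : ℕ} (hi : i ≤ 3) {θ : ℝ} (hθ : θ ∈ T) :
    ‖featDeriv Θ φ i θ‖ ≤ featBound Θ S K := by
  have hδ : min (supDeriv Θ S K 2 2) (supH Θ S K) ≤ |supDeriv Θ S K 2 2| :=
    (min_le_left _ _).trans (le_abs_self _)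
  refine Real.le_sqrt_of_sq_le ?_
  rw [← h.kernelDeriv_self hi (hK.subset (hT hθ))]
  have ha := abs_nonneg (supDeriv Θ S K 0 0)
  have hb := abs_nonneg (supDeriv Θ S K 1 1)
  have hc := abs_nonneg (supDeriv Θ S K 2 2)
  have hd := abs_nonneg (supH Θ S K)
  have hlow : ∀ j ≤ 2, kernelDeriv Θ (dictKernel φ) j j θ θ ≤
      |supDeriv Θ S K j j| + |supDeriv Θ S K 2 2| := fun j hj => by
    have h1 := (abs_le.1 (hclose.1 j hj j hj θ hθ θ hθ)).2
    have h2 : |kernelDeriv Θ K j j θ θ| ≤ supDeriv Θ S K j j :=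
      le_csSup (hK.bdd_deriv j hj j hj) ⟨(θ, θ), ⟨hT hθ, hT hθ⟩, rfl⟩
    linarith [le_abs_self (kernelDeriv Θ K j j θ θ), le_abs_self (supDeriv Θ S K j j)]
  have hhigh : kernelDeriv Θ (dictKernel φ) 3 3 θ θ ≤ |supH Θ S K| + |supDeriv Θ S K 2 2| := by
    have h1 := (abs_le.1 (hclose.2 θ hθ)).2
    have h2 : kernelH Θ K θ ≤ supH Θ S K := le_csSup hK.bdd_h ⟨θ, hT hθ, rfl⟩
    rw [kernelH] at h1
    linarith [le_abs_self (supH Θ S K)]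
  rcases (by omega : i = 0 ∨ i = 1 ∨ i = 2 ∨ i = 3) with rfl | rfl | rfl | rfl
  · linarith [hlow 0 (by norm_num)]
  · linarith [hlow 1 (by norm_num)]
  · linarith [hlow 2 (by norm_num)]
  · linarith

end Features

/-! ### The noise along a path of features -/

section Noise

variable {H : Type*} [NormedAddCommGroup H] [InnerProductSpace ℝ H] {Z : Type*}

/-- The map `v ↦ ⟨v, w⟩` from `H` to `L²(∑ a_z δ_z)`. -/
noncomputable def noiseMap [Fintype Z] (a : Z → ℝ) (w : Z → H) : H →L[ℝ] PiLp 2 (fun _ : Z => ℝ) :=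
  (PiLp.continuousLinearEquiv 2 ℝ (fun _ : Z => ℝ)).symm.toContinuousLinearMap ∘L
    ContinuousLinearMap.pi fun z => √(a z) • innerSL ℝ (w z)

theorem noiseMap_apply [Fintype Z] (a : Z → ℝ) (w : Z → H) (v : H) :
    noiseMap a w v = weightedVec a (fun z => ⟪v, w z⟫) := by
  ext z
  simp [noiseMap, real_inner_comm]

variable [Fintype Z] {Ω : Type*} [MeasurableSpace Ω] {P : Measure Ω} {W : Ω → Z → H} {σ Δ : ℝ}

theorem AdmissibleNoise.measure_lt_norm_noiseMap_le (hW : AdmissibleNoise P W σ Δ) {a : Z → ℝ}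
    {α m t : ℝ} (ha : ∀ z, 0 ≤ a z) (hα : ∀ z, a z ≤ α) (hαpos : 0 < α) (hσ : 0 < σ) (hΔ : 0 < Δ)
    (hm : 0 < m) {v : H} (hv : ‖v‖ ≤ m) (ht : 0 ≤ t) :
    P {ω | t < ‖noiseMap a (W ω) v‖} ≤ ENNReal.ofReal (√2 ^ Fintype.card Z *
      Real.exp (-(t ^ 2 / (4 * α * (σ ^ 2 * Δ * m ^ 2))))) := by
  simp only [noiseMap_apply]
  refine measure_lt_norm_weightedVec_le (X := fun z ω => ⟪v, W ω z⟫) ?_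
    (fun z => hW.gaussian z v) (fun z => hW.centered z v) ha hα hαpos (by positivity)
    (fun z => (hW.variance_le z v).trans ?_) ht
  · exact hW.indep.comp (fun _ g => g v) fun _ => measurable_pi_apply v
  · gcongr

/-- The supremum of the noise along a path of finite length in the dictionary. -/
theorem AdmissibleNoise.measure_exists_lt_norm_noiseMap_le (hW : AdmissibleNoise P W σ Δ)
    {a : Z → ℝ} {α l x A B : ℝ} (ha : ∀ z, 0 ≤ a z) (hα : ∀ z, a z ≤ α) (hαpos : 0 < α)
    (hσ : 0 < σ) (hΔ : 0 < Δ) (hl : 0 < l) (hx : 0 ≤ x) (hAB : A ≤ B) {ρ : ℝ → ℝ} {X D : ℝ → H}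
    (hρ : ContinuousOn ρ (Set.Icc A B)) (hρ0 : ∀ t ∈ Set.Icc A B, 0 ≤ ρ t)
    (hX : ∀ t ∈ Set.Icc A B, HasDerivWithinAt X (ρ t • D t) (Set.Icc A B) t)
    (hXl : ∀ t ∈ Set.Icc A B, ‖X t‖ ≤ l) (hDl : ∀ t ∈ Set.Icc A B, ‖D t‖ ≤ l)
    (hy : Real.exp (-(1 / (4 * α * (σ ^ 2 * Δ * l ^ 2)) * x ^ 2)) ≤ 1 / 4) :
    P {ω | ∃ t ∈ Set.Icc A B, 4 * x < ‖noiseMap a (W ω) (X t)‖} ≤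
      ENNReal.ofReal (2 * ((∫ t in A..B, ρ t) + 1) * √2 ^ Fintype.card Z *
        Real.exp (-(1 / (4 * α * (σ ^ 2 * Δ * l ^ 2)) * x ^ 2))) := by
  set L : ℝ := ∫ t in A..B, ρ t with hL
  set G : ℝ → ℝ := fun u => ∫ t in A..u, ρ t with hG
  have hρu : ContinuousOn ρ (Set.uIcc A B) := by rwa [Set.uIcc_of_le hAB]
  have hL0 : 0 ≤ L := intervalIntegral.integral_nonneg hAB hρ0
  have hGc : ContinuousOn G (Set.Icc A B) := by
    rw [← Set.uIcc_of_le hAB]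
    exact fun t ht => (hasDerivWithinAt_integral_of_continuousOn hρu ht).continuousWithinAt
  -- Reparametrization by arc length. As `ρ` is only nonnegative, `G` may fail to be injective and
  -- some preimage is chosen.
  have hex : ∀ t, ∃ θ, t ∈ Set.Icc 0 L → θ ∈ Set.Icc A B ∧ G θ = t := fun t => by
    by_cases ht : t ∈ Set.Icc 0 L
    · have h1 := intermediate_value_Icc hAB hGc
      have h2 : G A = 0 := by simp [hG]
      rw [h2] at h1
      obtain ⟨θ, hθ, hθ'⟩ := h1 ht
      exact ⟨θ, fun _ => ⟨hθ, hθ'⟩⟩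
    · exact ⟨0, fun h => absurd h ht⟩
  choose θ hθ using hex
  have hlip : ∀ s ∈ Set.Icc 0 L, ∀ t ∈ Set.Icc 0 L, ‖X (θ s) - X (θ t)‖ ≤ l * |s - t| := by
    intro s hs t ht
    obtain ⟨hs1, hs2⟩ := hθ s hs
    obtain ⟨ht1, ht2⟩ := hθ t ht
    have hsub : Set.uIcc (θ t) (θ s) ⊆ Set.Icc A B := Set.ordConnected_Icc.uIcc_subset ht1 hs1
    have h1 := norm_sub_le_mul_abs_integral (hρ.mono hsub) (fun u hu => hρ0 u (hsub hu))
      (fun u hu => (hX u (hsub hu)).mono hsub) (fun u hu => hDl u (hsub hu))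
    have hii : ∀ u ∈ Set.Icc A B, IntervalIntegrable ρ volume A u := fun u hu =>
      (hρ.mono (Set.ordConnected_Icc.uIcc_subset ⟨le_rfl, hAB⟩ hu)).intervalIntegrable
    have h2 : ∫ u in θ t..θ s, ρ u = s - t := by
      rw [← intervalIntegral.integral_interval_sub_left (hii _ hs1) (hii _ ht1)]
      exact congrArg₂ _ hs2 ht2
    rwa [h2] at h1
  have hmain := measure_exists_lt_norm_le_of_increments (P := P)
    (Y := fun t ω => noiseMap a (W ω) (X (θ t))) (L := L) (A := √2 ^ Fintype.card Z)
    (β := 1 / (4 * α * (σ ^ 2 * Δ * l ^ 2))) (x := x) hL0 (by positivity) (by positivity) hx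
    ?_ ?_ ?_ hy
  · refine (measure_mono ?_).trans hmain
    rintro ω ⟨t, ht, hlt⟩
    have hGt : G t ∈ Set.Icc 0 L := by
      refine ⟨intervalIntegral.integral_nonneg ht.1 fun u hu => hρ0 u ⟨hu.1, hu.2.trans ht.2⟩, ?_⟩
      refine intervalIntegral.integral_mono_interval le_rfl ht.1 ht.2 ?_ hρu.intervalIntegrable
      exact (ae_restrict_mem measurableSet_Ioc).mono fun u hu => hρ0 u (Set.Ioc_subset_Icc_self hu)
    refine ⟨G t, hGt, ?_⟩
    obtain ⟨h1, h2⟩ := hθ (G t) hGt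
    have hsub : Set.uIcc t (θ (G t)) ⊆ Set.Icc A B := Set.ordConnected_Icc.uIcc_subset ht h1
    have h3 := norm_sub_le_mul_abs_integral (hρ.mono hsub) (fun u hu => hρ0 u (hsub hu))
      (fun u hu => (hX u (hsub hu)).mono hsub) (fun u hu => hDl u (hsub hu))
    have hii : ∀ u ∈ Set.Icc A B, IntervalIntegrable ρ volume A u := fun u hu =>
      (hρ.mono (Set.ordConnected_Icc.uIcc_subset ⟨le_rfl, hAB⟩ hu)).intervalIntegrable
    -- The chosen preimage of `G t` may differ from `t`, but the arc between them has length zero,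
    -- so `X` agrees at both.
    have h4 : ∫ u in t..θ (G t), ρ u = 0 := by
      rw [← intervalIntegral.integral_interval_sub_left (hii _ h1) (hii _ ht)]
      exact sub_eq_zero.2 h2
    rw [h4, abs_zero, mul_zero, norm_le_zero_iff, sub_eq_zero] at h3
    rwa [h3]
  · intro ω
    refine (noiseMap a (W ω)).continuous.comp_continuousOn
      (LipschitzOnWith.continuousOn (K := l.toNNReal) ?_)
    refine LipschitzOnWith.of_dist_le_mul fun s hs t ht => ?_
    rw [dist_eq_norm, Real.dist_eq, Real.coe_toNNReal _ hl.le]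
    exact hlip s hs t ht
  · intro t ht u hu
    have := hW.measure_lt_norm_noiseMap_le ha hα hαpos hσ hΔ hl (hXl _ (hθ t ht).1) hu
    rwa [← one_div_mul_eq_div] at this
  · intro s hs t ht d hd hst u hu
    have h1 : ‖X (θ s) - X (θ t)‖ ≤ l * d :=
      (hlip s hs t ht).trans (mul_le_mul_of_nonneg_left hst hl.le)
    have := hW.measure_lt_norm_noiseMap_le ha hα hαpos hσ hΔ (mul_pos hl hd) h1 hu
    simp only [map_sub] at this
    have e : u ^ 2 / (4 * α * (σ ^ 2 * Δ * (l * d) ^ 2)) =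
        1 / (4 * α * (σ ^ 2 * Δ * l ^ 2)) * (u / d) ^ 2 := by
      field_simp
    rwa [e] at this

/-- The comparison of the chaining bound with the rate `√n e^{-n/2}`. -/
theorem chaining_tail_le_rate {n : ℕ} (hn : 1 ≤ n) {τ L y : ℝ} (hτ : 1 < τ) (hL : 0 ≤ L)
    (hy : 2 * n + Real.log τ ≤ y) :
    Real.exp (-y) ≤ 1 / 4 ∧ 2 * (L + 1) * √2 ^ n * Real.exp (-y) ≤
      2 * (1 / τ + L * (√n * Real.exp (-n / 2)) / √τ) := by
  have hτ0 : 0 < τ := by linarith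
  have hn1 : (1 : ℝ) ≤ n := by exact_mod_cast hn
  have hlog : 0 ≤ Real.log τ := Real.log_nonneg hτ.le
  have he : (2 : ℝ) ≤ Real.exp 1 := by linarith [Real.exp_one_gt_d9]
  constructor
  · have h1 : Real.exp (-y) ≤ Real.exp (-1) * Real.exp (-1) := by
      rw [← Real.exp_add]
      exact Real.exp_le_exp.2 (by linarith)
    have h2 : Real.exp (-1) ≤ 1 / 2 := by
      rw [Real.exp_neg, one_div]
      exact inv_anti₀ two_pos he
    nlinarith [Real.exp_pos (-1)]
  · have h1 : √2 ^ n ≤ Real.exp n := by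
      have h2 : √2 ≤ Real.exp 1 := (Real.sqrt_le_iff.2 ⟨by norm_num, by norm_num⟩).trans he
      calc √2 ^ n ≤ Real.exp 1 ^ n := by gcongr
        _ = Real.exp n := by rw [← Real.exp_nat_mul, mul_one]
    have h3 : √2 ^ n * Real.exp (-y) ≤ Real.exp (-n) / τ := by
      calc √2 ^ n * Real.exp (-y) ≤ Real.exp n * Real.exp (-(2 * n + Real.log τ)) := by gcongr
        _ = Real.exp (-n) / τ := by
          have h2 : τ⁻¹ = Real.exp (-Real.log τ) := by rw [Real.exp_neg, Real.exp_log hτ0]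
          rw [← Real.exp_add, div_eq_mul_inv, h2, ← Real.exp_add]
          congr 1
          ring
    have h4 : Real.exp (-n) / τ ≤ 1 / τ := by
      gcongr
      exact Real.exp_le_one_iff.2 (by linarith)
    have h5 : Real.exp (-n) / τ ≤ (√n * Real.exp (-n / 2)) / √τ := by
      have h6 : Real.exp (-n) ≤ √n * Real.exp (-n / 2) := by
        have h7 : 1 ≤ √(n : ℝ) := Real.one_le_sqrt.2 hn1
        have h8 : Real.exp (-n) ≤ Real.exp (-n / 2) := Real.exp_le_exp.2 (by linarith)
        nlinarith [Real.exp_pos (-(n : ℝ) / 2)]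
      have h9 : √τ ≤ τ := by
        rw [Real.sqrt_le_left hτ0.le]
        nlinarith
      have : 0 < √τ := Real.sqrt_pos.2 hτ0
      gcongr
    -- In `L + 1`, the 1 is charged to `1 / τ` and `L` to the term with `√τ`.
    calc 2 * (L + 1) * √2 ^ n * Real.exp (-y) = 2 * ((L + 1) * (√2 ^ n * Real.exp (-y))) := by ring
      _ ≤ 2 * ((L + 1) * (Real.exp (-n) / τ)) := by gcongr
      _ ≤ _ := by
        have := mul_le_mul_of_nonneg_left h5 hL
        rw [mul_div_assoc]
        linarith

/-- The lower bound for `κ` controls the exponent in the chaining bound. -/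
theorem exponent_ge_of_penalty_ge {n : ℕ} (hn : 1 ≤ n) {τ κ σ Δ α l c ν : ℝ} (hτ : 1 < τ)
    (hσ : 0 < σ) (hΔ : 0 < Δ) (hα : 0 < α) (hl : 0 < l) (hc : 0 < c) (hν : 0 < ν)
    (hκ : 8 * l / c * σ * √(α * Δ * n / ν ^ 2) * (1 + √(1 + Real.log τ / n)) ≤ κ) :
    2 * n + Real.log τ ≤
      1 / (4 * α * (σ ^ 2 * Δ * l ^ 2)) * (c * (ν * κ) / 4) ^ 2 := by
  have hn0 : (0 : ℝ) < n := by exact_mod_cast hn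
  have hlog : 0 ≤ Real.log τ := Real.log_nonneg hτ.le
  have h1 : (8 * l / c * σ * √(α * Δ * n / ν ^ 2) * (1 + √(1 + Real.log τ / n))) ^ 2 ≤ κ ^ 2 := by
    gcongr
  have h2 : 2 + Real.log τ / n ≤ (1 + √(1 + Real.log τ / n)) ^ 2 := by
    have h3 : √(1 + Real.log τ / n) ^ 2 = 1 + Real.log τ / n := Real.sq_sqrt (by positivity)
    nlinarith [Real.sqrt_nonneg (1 + Real.log τ / n)]
  rw [mul_pow, mul_pow, Real.sq_sqrt (by positivity)] at h1
  have h4 : (8 * l / c * σ) ^ 2 * (α * Δ * n / ν ^ 2) * (2 + Real.log τ / n) ≤ κ ^ 2 :=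
    (mul_le_mul_of_nonneg_left h2 (by positivity)).trans h1
  -- The 8 in the penalty makes this an equality: `8² / (4 · 4²) = 1`.
  calc 2 * n + Real.log τ = 1 / (4 * α * (σ ^ 2 * Δ * l ^ 2)) * (c * ν / 4) ^ 2 *
        ((8 * l / c * σ) ^ 2 * (α * Δ * n / ν ^ 2) * (2 + Real.log τ / n)) := by
        field_simp
        ring
    _ ≤ 1 / (4 * α * (σ ^ 2 * Δ * l ^ 2)) * (c * ν / 4) ^ 2 * κ ^ 2 :=
        mul_le_mul_of_nonneg_left h4 (by positivity)
    _ = _ := by ring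

/-- The bad set is an uncountable union and need not be measurable; the complement of its measurable
hull serves as the event. -/
theorem exists_measurableSet_of_measure_compl_le [IsProbabilityMeasure P] {S : Set Ω} {ε : ℝ}
    (hε : 0 ≤ ε) (hS : P S ≤ ENNReal.ofReal ε) :
    ∃ A : Set Ω, MeasurableSet A ∧ 1 - ε ≤ P.real A ∧ ∀ ω ∈ A, ω ∉ S := by
  refine ⟨(toMeasurable P S)ᶜ, (measurableSet_toMeasurable P S).compl, ?_,
    fun ω hω h => hω (subset_toMeasurable P S h)⟩
  rw [probReal_compl_eq_one_sub (measurableSet_toMeasurable P S), Measure.real,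
    measure_toMeasurable]
  have := ENNReal.toReal_le_of_le_ofReal hε hS
  linarith

end Noise

/-! ### The prediction error on the event where the noise is small -/

section Prediction

variable {H : Type*} [NormedAddCommGroup H] [InnerProductSpace ℝ H] {Z : Type*}
  {a : Z → ℝ}

theorem weightedVec_mixture {K : ℕ} (φ : ℝ → H) (B : Z → EuclideanSpace ℝ (Fin K))
    (ϑ : Fin K → ℝ) :
    weightedVec a (mixture φ B ϑ) =
      ∑ k, weightedVec a (fun z => B z k • normFeature φ (ϑ k)) := by
  rw [← map_sum]
  congr 1
  ext z
  simp [mixture]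

variable [Fintype Z]

theorem inner_weightedVec_mixture (ha : ∀ z, 0 ≤ a z) {K : ℕ} (φ : ℝ → H)
    (B : Z → EuclideanSpace ℝ (Fin K)) (ϑ : Fin K → ℝ) (p : Z → H) :
    ⟪weightedVec a (mixture φ B ϑ), weightedVec a p⟫ =
      ∑ k, ⟪weightedVec a (fun z => B z k),
        weightedVec a (fun z => ⟪normFeature φ (ϑ k), p z⟫)⟫ := by
  rw [weightedVec_mixture, sum_inner]
  exact Finset.sum_congr rfl fun k _ => inner_weightedVec_smul ha _ _ _

/-- The optimality of the estimator, after expansion of the squares. -/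
theorem IsEstimator.sq_error_le [MeasurableSpace Z] [MeasurableSingletonClass Z]
    (ha : ∀ z, 0 ≤ a z) {ν : Measure Z}
    (hν : ν = ∑ z, ENNReal.ofReal (a z) • Measure.dirac z) (hν0 : 0 < ν.real Set.univ)
    {K : ℕ} {φ : ℝ → H} {T : Set ℝ} {κ : ℝ} {Y w : Z → H}
    {Bhat Bstar : Z → EuclideanSpace ℝ (Fin K)} {ϑhat ϑstar : Fin K → ℝ}
    (h : IsEstimator φ T ν 2 κ Y Bhat ϑhat) (hB : MemLp Bstar 2 ν) (hϑ : ∀ k, ϑstar k ∈ T)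
    (hY : ∀ᵐ z ∂ν, Y z = mixture φ Bstar ϑstar z + w z) :
    ‖weightedVec a (mixture φ Bhat ϑhat - mixture φ Bstar ϑstar)‖ ^ 2 / 2 ≤
      ⟪weightedVec a (mixture φ Bhat ϑhat - mixture φ Bstar ϑstar), weightedVec a w⟫ +
      ν.real Set.univ * κ * (∑ k, ‖weightedVec a (fun z => Bstar z k)‖ -
        ∑ k, ‖weightedVec a (fun z => Bhat z k)‖) := by
  have hnorm : ∀ (B : Z → EuclideanSpace ℝ (Fin K)) (ϑ : Fin K → ℝ),
      normL 2 ν (Y - mixture φ B ϑ) =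
        ‖weightedVec a (mixture φ Bstar ϑstar + w - mixture φ B ϑ)‖ := fun B ϑ => by
    rw [← normL_two_eq ha hν, normL, normL]
    congr 1
    exact eLpNorm_congr_ae (hY.mono fun z hz => by simp [hz])
  have hle := h.le Bstar ϑstar hB hϑ
  simp only [objective, hnorm, normL_two_eq ha hν] at hle
  set e := weightedVec a (mixture φ Bhat ϑhat - mixture φ Bstar ϑstar) with he
  have h1 : weightedVec a (mixture φ Bstar ϑstar + w - mixture φ Bhat ϑhat) =
      weightedVec a w - e := by
    rw [he, ← map_sub]
    congr 1
    abel
  have h2 : mixture φ Bstar ϑstar + w - mixture φ Bstar ϑstar = w := by abel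
  rw [h1, h2, norm_sub_sq_real, real_inner_comm] at hle
  set ν' := ν.real Set.univ
  have h3 := mul_le_mul_of_nonneg_left hle hν0.le
  have h4 : ∀ u v : ℝ, ν' * (1 / (2 * ν') * u + κ * v) = u / 2 + ν' * κ * v := fun u v => by
    field_simp
  rw [h4, h4] at h3
  linarith

theorem dictBall_self_mem {Θ T : Set ℝ} {φ : ℝ → H} {θ r : ℝ} (hr : 0 ≤ r) (hθ : θ ∈ T) :
    θ ∈ dictBall Θ T φ θ r := by
  refine ⟨hθ, ?_⟩
  simpa [riemDist] using hr

theorem riemDist_self (Θ : Set ℝ) (k : ℝ → ℝ → ℝ) (θ : ℝ) : riemDist Θ k θ θ = 0 := by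
  simp [riemDist]

/-- Identifies the signed distance of the derivative certificate with the oriented integral
appearing in the Taylor expansion. -/
theorem sign_sub_mul_riemDist (Θ : Set ℝ) (φ : ℝ → H) (x y : ℝ) :
    Real.sign (y - x) * riemDist Θ (dictKernel φ) y x = ∫ t in x..y, dictSpeed Θ φ t := by
  have h0 : ∀ t, 0 ≤ dictSpeed Θ φ t := fun t => Real.sqrt_nonneg _
  change Real.sign (y - x) * |∫ t in y..x, dictSpeed Θ φ t| = _
  rcases lt_trichotomy x y with h | rfl | h
  · rw [Real.sign_of_pos (sub_pos.2 h), one_mul, intervalIntegral.integral_symm, abs_neg,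
      abs_of_nonneg (intervalIntegral.integral_nonneg h.le fun t _ => h0 t)]
  · simp
  · rw [Real.sign_of_neg (sub_neg.2 h),
      abs_of_nonneg (intervalIntegral.integral_nonneg h.le fun t _ => h0 t),
      intervalIntegral.integral_symm]
    ring

/-- Any family of unit vectors attached to the active indices is a sign pattern on `Q⋆`. -/
theorem exists_sign_pattern [MeasurableSpace Z] [MeasurableSingletonClass Z]
    (ha : ∀ z, 0 ≤ a z) {ν : Measure Z}
    (hν : ν = ∑ z, ENNReal.ofReal (a z) • Measure.dirac z)
    {K : ℕ} {S : Set (Fin K)} {ϑ : Fin K → ℝ} (hinj : Set.InjOn ϑ S)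
    {v : Fin K → PiLp 2 (fun _ : Z => ℝ)}
    (hv : ∀ k, v k ∈ LinearMap.range (weightedVec (E := ℝ) a)) (hv1 : ∀ k, ‖v k‖ = 1) :
    ∃ V : Z → ℝ → ℝ, (∀ k ∈ S, weightedVec a (fun z => V z (ϑ k)) = v k) ∧
      ∀ θ ∈ ϑ '' S, Measurable (fun z => V z θ) ∧ normL 2 ν (fun z => V z θ) = 1 := by
  choose g hg using hv
  have key : ∀ θ, ∃ f : Z → ℝ, ∀ k ∈ S, ϑ k = θ → f = g k := fun θ => by
    by_cases h : ∃ k ∈ S, ϑ k = θ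
    · obtain ⟨k, hk, rfl⟩ := h
      exact ⟨g k, fun k' hk' h' => by rw [hinj hk' hk h']⟩
    · exact ⟨0, fun k hk h' => absurd ⟨k, hk, h'⟩ h⟩
  choose f hf using key
  have h1 : ∀ k ∈ S, weightedVec a (fun z => f (ϑ k) z) = v k := fun k hk => by
    rw [← hg k, hf (ϑ k) k hk rfl]
  refine ⟨fun z θ => f θ z, h1, ?_⟩
  rintro _ ⟨k, hk, rfl⟩
  exact ⟨measurable_of_finite _, by rw [normL_two_eq ha hν, h1 k hk, hv1 k]⟩

/-- Instance of `prediction_error_le` with `R = √s`, penalty `ν(Z) κ`, and noise values given by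
`noiseMap` on the features of orders 0 and 1; order 2 bounds the Taylor remainder. -/
theorem norm_mixture_sub_le [MeasurableSpace Z] [MeasurableSingletonClass Z]
    {Θ T : Set ℝ} {φ : ℝ → H} (hφ : IsRegularDictionary Θ φ) (hT : T.OrdConnected) (hTΘ : T ⊆ Θ)
    (ha : ∀ z, 0 ≤ a z) {ν : Measure Z}
    (hν : ν = ∑ z, ENNReal.ofReal (a z) • Measure.dirac z) (hν0 : 0 < ν.real Set.univ)
    {r CN CN' CF CB cN cF cB m κ M : ℝ} (hr : 0 < r) (hm : 0 < m) (hmN : m ≤ CN) (hmF : m ≤ CF)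
    (hCN' : 0 < CN') (hCB : 0 < CB) (hcN : 0 < cN) (hcF : 0 < cF) (hcB : 0 < cB)
    {K s : ℕ} {Bstar Bhat : Z → EuclideanSpace ℝ (Fin K)} {ϑstar ϑhat : Fin K → ℝ}
    (hB : MemLp Bstar 2 ν) (hϑ : ∀ k, ϑstar k ∈ T) (hs : (activeSet ν Bstar).ncard = s)
    (hP : InterpolatingCertificate Θ T φ ν 2 2 s r (ϑstar '' activeSet ν Bstar) CN CN' CF CB)
    (hQ : DerivativeCertificate Θ T φ ν 2 2 s r (ϑstar '' activeSet ν Bstar) cN cF cB)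
    {Y w : Z → H} (hY : ∀ᵐ z ∂ν, Y z = mixture φ Bstar ϑstar z + w z) (hκ : 0 ≤ κ)
    (hw : ∀ i ≤ 2, ∀ θ ∈ T, ‖noiseMap a w (featDeriv Θ φ i θ)‖ ≤ M) (hM0 : 0 ≤ M)
    (hM : M ≤ m / (2 * (2 + CN' + cN + cF)) * (ν.real Set.univ * κ))
    (hest : IsEstimator φ T ν 2 κ Y Bhat ϑhat) :
    ‖weightedVec a (mixture φ Bhat ϑhat - mixture φ Bstar ϑstar)‖ ≤
      2 * ((m * (CB + cB) + CB) * (1 + (m + 2 * CN' + 2) / m)) * √s *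
        (ν.real Set.univ * κ) := by
  classical
  set Act := activeSet ν Bstar with hAct
  set S : Finset (Fin K) := Finset.univ.filter (· ∈ Act) with hS
  have hmemS : ∀ k, k ∈ S ↔ k ∈ Act := fun k => by simp [hS]
  -- The active set and its image both have `s` elements, so signs indexed by `k` can be read as
  -- signs indexed by the true parameter.
  have hinj : Set.InjOn ϑstar Act :=
    Set.injOn_of_ncard_image_eq (by rw [hP.separated.ncard, hs]) (Set.toFinite _)
  set N : Finset (Fin K) :=
    Finset.univ.filter (fun l => ∃ k ∈ Act, ϑhat l ∈ dictBall Θ T φ (ϑstar k) r) with hN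
  have hex : ∀ l, ∃ k, l ∈ N → k ∈ S ∧ ϑhat l ∈ dictBall Θ T φ (ϑstar k) r := fun l => by
    by_cases hl : l ∈ N
    · obtain ⟨k, hk, hk'⟩ := (Finset.mem_filter.1 hl).2
      exact ⟨k, fun _ => ⟨(hmemS k).2 hk, hk'⟩⟩
    · exact ⟨l, fun h => absurd h hl⟩
  choose c hc using hex
  have hfar : ∀ l ∉ N, ∀ θs ∈ ϑstar '' Act, ϑhat l ∉ dictBall Θ T φ θs r := by
    rintro l hl _ ⟨k, hk, rfl⟩ hcon
    exact hl (Finset.mem_filter.2 ⟨Finset.mem_univ _, k, hk, hcon⟩)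
  set x : Fin K → ℝ := fun l => ∫ t in (ϑstar (c l))..(ϑhat l), dictSpeed Θ φ t with hx
  have hx2 : ∀ l, x l ^ 2 = riemDist Θ (dictKernel φ) (ϑstar (c l)) (ϑhat l) ^ 2 := fun l =>
    (sq_abs _).symm
  set b : Fin K → PiLp 2 (fun _ : Z => ℝ) := fun l => weightedVec a (fun z => Bhat z l) with hb
  set bs : Fin K → PiLp 2 (fun _ : Z => ℝ) := fun k => weightedVec a (fun z => Bstar z k) with hbs
  have hbs0 : ∀ k ∉ S, bs k = 0 := fun k hk => by
    rw [hmemS, hAct, activeSet, Set.mem_ofPred_eq, not_not, normL_two_eq ha hν] at hk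
    exact norm_eq_zero.1 hk
  set e := weightedVec a (mixture φ Bhat ϑhat - mixture φ Bstar ϑstar) with he
  have hpair : ∀ p : Z → H, ⟪e, weightedVec a p⟫ =
      ∑ l, ⟪b l, weightedVec a (fun z => ⟪normFeature φ (ϑhat l), p z⟫)⟫ -
      ∑ k ∈ S, ⟪bs k, weightedVec a (fun z => ⟪normFeature φ (ϑstar k), p z⟫)⟫ := fun p => by
    rw [he, map_sub, inner_sub_left, inner_weightedVec_mixture ha, inner_weightedVec_mixture ha]
    congr 1
    refine (Finset.sum_subset (Finset.subset_univ S) fun k _ hk => ?_).symm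
    have := hbs0 k hk
    rw [hbs] at this
    simp only at this
    rw [this, inner_zero_left]
  -- For `p = q = 2` the power of the total mass in the certificates is zero.
  have hexp : ∀ C : ℝ, C * √s * ν.real Set.univ ^
      (1 / (2 * (2 : ℝ≥0∞).toReal) - 1 / (2 * (2 : ℝ≥0∞).toReal)) = C * √s := fun C => by simp
  have hmassE : ∃ u ∈ LinearMap.range (weightedVec (E := ℝ) a), ‖u‖ = 1 := by
    refine ⟨_, ⟨fun _ => (√(∑ z, a z))⁻¹, rfl⟩, ?_⟩
    have : 0 < √(∑ z, a z) := by
      rw [← real_univ_sum_smul_dirac ha hν]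
      exact Real.sqrt_pos.2 hν0
    rw [norm_weightedVec_const ha, norm_inv, Real.norm_of_nonneg this.le,
      mul_inv_cancel₀ this.ne']
  obtain ⟨u, huV, hu⟩ := hmassE
  have hρ : ContinuousOn (dictSpeed Θ φ) Θ := hφ.contDiffOn_dictSpeed.continuousOn
  have hwder : ∀ i < 3, ∀ θ ∈ Θ, HasDerivWithinAt (fun t => noiseMap a w (featDeriv Θ φ i t))
      (dictSpeed Θ φ θ • noiseMap a w (featDeriv Θ φ (i + 1) θ)) Θ θ := fun i hi θ hθ => by
    rw [← map_smul]
    exact (noiseMap a w).hasFDerivAt.comp_hasDerivWithinAt θ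
      (hφ.hasDerivWithinAt_featDeriv hi hθ)
  have hopt := hest.sq_error_le ha hν hν0 hB hϑ hY
  rw [← he] at hopt
  refine prediction_error_le (N := N) (S := S) (c := c) (x := x) (b := b) (bs := bs)
    (V := LinearMap.range (weightedVec (E := ℝ) a)) (cN := cN) (cF := cF) (M := M)
    (w := fun l => noiseMap a w (featDeriv Θ φ 0 (ϑhat l)))
    (ws := fun k => noiseMap a w (featDeriv Θ φ 0 (ϑstar k)))
    (ws' := fun k => noiseMap a w (featDeriv Θ φ 1 (ϑstar k)))
    (fun l => ⟨_, rfl⟩) (fun k => ⟨_, rfl⟩) huV hu (fun l hl => (hc l hl).1) hm hmN hmF hCN' hCB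
    hcN hcF hcB (norm_nonneg _) (Real.sqrt_nonneg _) (by positivity) hM0 hM ?_ ?_
    (fun k _ => hw 0 (by norm_num) _ (hϑ k)) (fun k _ => hw 1 (by norm_num) _ (hϑ k)) ?_
    (fun l _ => hw 0 (by norm_num) _ (hest.mem l)) ?_
  · intro v hv hv1
    obtain ⟨V, hV, hV'⟩ := exists_sign_pattern ha hν hinj hv hv1
    obtain ⟨p, -, h1, h2, h3, h4⟩ := hP.certificate V hV'
    simp only [normL_two_eq ha hν] at h1 h2 h3 h4
    rw [hexp] at h4
    have hsub : ∀ k ∈ S, ∀ θ, weightedVec a (fun z => ⟪normFeature φ θ, p z⟫ - V z (ϑstar k)) =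
        weightedVec a (fun z => ⟪normFeature φ θ, p z⟫) - v k := fun k hk θ => by
      rw [← hV k ((hmemS k).1 hk), ← map_sub]
      rfl
    refine ⟨fun l => weightedVec a (fun z => ⟪normFeature φ (ϑhat l), p z⟫), ?_, ?_, ?_, ?_⟩
    · intro l hl
      obtain ⟨hk, hball⟩ := hc l hl
      rw [hx2]
      exact h1 _ ⟨_, (hmemS _).1 hk, rfl⟩ _ hball
    · intro l hl
      obtain ⟨hk, hball⟩ := hc l hl
      have := h2 _ ⟨_, (hmemS _).1 hk, rfl⟩ _ hball
      rwa [hsub _ hk, ← hx2] at this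
    · exact fun l hl => h3 _ (hest.mem l) (hfar l hl)
    -- At a true parameter the distance is zero, so the certificate interpolates exactly; the
    -- required difference is then `⟪e, p⟫`, and Cauchy–Schwarz applies.
    · have h5 : ∀ k ∈ S, weightedVec a (fun z => ⟪normFeature φ (ϑstar k), p z⟫) = v k := by
        intro k hk
        have := h2 _ ⟨k, (hmemS _).1 hk, rfl⟩ _ (dictBall_self_mem hr.le (hϑ k))
        rw [hsub _ hk, riemDist_self] at this
        rw [← sub_eq_zero, ← norm_le_zero_iff]
        simpa using this
      have h6 := hpair p
      rw [Finset.sum_congr (s₁ := S) rfl fun k hk => by rw [h5 k hk]] at h6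
      rw [← h6, mul_comm]
      exact (abs_real_inner_le_norm _ _).trans (mul_le_mul_of_nonneg_left h4 (norm_nonneg _))
  · intro v hv hv1
    obtain ⟨V, hV, hV'⟩ := exists_sign_pattern ha hν hinj hv hv1
    obtain ⟨q, -, h1, h2, h4⟩ := hQ.certificate V hV'
    simp only [normL_two_eq ha hν] at h1 h2 h4
    rw [hexp] at h4
    have hsub : ∀ k ∈ S, ∀ θ, weightedVec a (fun z => ⟪normFeature φ θ, q z⟫ -
        V z (ϑstar k) * Real.sign (θ - ϑstar k) * riemDist Θ (dictKernel φ) θ (ϑstar k)) =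
        weightedVec a (fun z => ⟪normFeature φ θ, q z⟫) -
          (∫ t in (ϑstar k)..θ, dictSpeed Θ φ t) • v k := fun k hk θ => by
      rw [← hV k ((hmemS k).1 hk), ← map_smul, ← map_sub]
      congr 1
      ext z
      simp only [Pi.sub_apply, Pi.smul_apply, smul_eq_mul]
      rw [mul_assoc, sign_sub_mul_riemDist, mul_comm]
    refine ⟨fun l => weightedVec a (fun z => ⟪normFeature φ (ϑhat l), q z⟫), ?_, ?_, ?_⟩
    · intro l hl
      obtain ⟨hk, hball⟩ := hc l hl
      have := h1 _ ⟨_, (hmemS _).1 hk, rfl⟩ _ hball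
      rwa [hsub _ hk, ← hx2] at this
    · exact fun l hl => h2 _ (hest.mem l) (hfar l hl)
    -- The derivative certificate vanishes at the true parameters, so `B⋆` drops out of the pairing.
    · have h5 : ∀ k ∈ S, weightedVec a (fun z => ⟪normFeature φ (ϑstar k), q z⟫) = 0 := by
        intro k hk
        have := h1 _ ⟨k, (hmemS _).1 hk, rfl⟩ _ (dictBall_self_mem hr.le (hϑ k))
        rw [hsub _ hk, riemDist_self, intervalIntegral.integral_same, zero_smul, sub_zero] at this
        rw [← norm_le_zero_iff]
        simpa using this
      have h6 := hpair q
      rw [Finset.sum_eq_zero (s := S) fun k hk => by rw [h5 k hk, inner_zero_right],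
        sub_zero] at h6
      rw [← h6, mul_comm]
      exact (abs_real_inner_le_norm _ _).trans (mul_le_mul_of_nonneg_left h4 (norm_nonneg _))
  · intro l hl
    have hsub : Set.uIcc (ϑstar (c l)) (ϑhat l) ⊆ T := hT.uIcc_subset (hϑ _) (hest.mem l)
    exact norm_taylor_le_mul_integral_sq hM0 (hρ.mono (hsub.trans hTΘ))
      (fun t _ => Real.sqrt_nonneg _)
      (fun t ht => (hwder 0 (by norm_num) t (hTΘ (hsub ht))).mono (hsub.trans hTΘ))
      (fun t ht => (hwder 1 (by norm_num) t (hTΘ (hsub ht))).mono (hsub.trans hTΘ))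
      (fun t ht => hw 2 le_rfl t (hsub ht))
  · have h1 : ∑ k ∈ S, ‖bs k‖ = ∑ k, ‖bs k‖ :=
      Finset.sum_subset (Finset.subset_univ S) fun k _ hk => by rw [hbs0 k hk, norm_zero]
    rw [h1]
    have h2 := hpair w
    simp only [noiseMap_apply]
    change _ ≤ (∑ l, ⟪b l, weightedVec a (fun z => ⟪normFeature φ (ϑhat l), w z⟫)⟫ -
      ∑ k ∈ S, ⟪bs k, weightedVec a (fun z => ⟪normFeature φ (ϑstar k), w z⟫)⟫) + _
    rw [← h2]
    exact hopt

end Prediction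

/-! ### The probability of the event -/

section Event

variable {H : Type*} [NormedAddCommGroup H] [InnerProductSpace ℝ H] {Z : Type*} [Fintype Z]

theorem integral_dictSpeed_le_riemDiam {Θ : Set ℝ} {φ : ℝ → H} (hφ : IsRegularDictionary Θ φ)
    {A B : ℝ} (hAB : A ≤ B) (hsub : Set.Icc A B ⊆ Θ) :
    ∫ t in A..B, dictSpeed Θ φ t ≤ riemDiam Θ (dictKernel φ) (Set.Icc A B) := by
  have hρ : ContinuousOn (dictSpeed Θ φ) (Set.Icc A B) :=
    hφ.contDiffOn_dictSpeed.continuousOn.mono hsub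
  have h0 : ∀ t, 0 ≤ dictSpeed Θ φ t := fun t => Real.sqrt_nonneg _
  rw [← Set.uIcc_of_le hAB] at hρ
  refine (le_abs_self _).trans (le_csSup ⟨|∫ t in A..B, dictSpeed Θ φ t|, ?_⟩
    ⟨(A, B), ⟨Set.left_mem_Icc.2 hAB, Set.right_mem_Icc.2 hAB⟩, rfl⟩)
  rintro _ ⟨⟨x, y⟩, ⟨hx, hy⟩, rfl⟩
  rw [← Set.uIcc_of_le hAB] at hx hy
  exact intervalIntegral.abs_integral_mono_interval
    (Set.uIoc_subset_uIoc_of_uIcc_subset_uIcc (Set.uIcc_subset_uIcc hx hy))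
    (Filter.Eventually.of_forall h0) hρ.intervalIntegrable

/-- Chaining for order `i` uses the bound on order `i + 1 ≤ 3` as Lipschitz constant; the three
orders turn the factor 2 into 6. -/
theorem AdmissibleNoise.measure_exists_lt_norm_featDeriv_le {Θ S T : Set ℝ} {k : ℝ → ℝ → ℝ}
    {φ : ℝ → H} (hφ : IsRegularDictionary Θ φ) (hk : IsLimitKernel Θ S k) (hTS : T ⊆ S)
    (hTc : IsCompact T) (hT : T.OrdConnected)
    (hclose : KernelsClose Θ T (dictKernel φ) k (min (supDeriv Θ S k 2 2) (supH Θ S k)))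
    {Ω : Type*} [MeasurableSpace Ω] {P : Measure Ω} {W : Ω → Z → H} {σ Δ : ℝ}
    (hW : AdmissibleNoise P W σ Δ) {a : Z → ℝ} (ha : ∀ z, 0 ≤ a z) (hapos : 0 < ‖a‖)
    (hσ : 0 < σ) (hΔ : 0 < Δ) (hn : 1 ≤ Fintype.card Z) {τ x : ℝ} (hτ : 1 < τ) (hx : 0 ≤ x)
    (hy : 2 * Fintype.card Z + Real.log τ ≤
      1 / (4 * ‖a‖ * (σ ^ 2 * Δ * featBound Θ S k ^ 2)) * x ^ 2) :
    P {ω | ∃ i ≤ 2, ∃ θ ∈ T, 4 * x < ‖noiseMap a (W ω) (featDeriv Θ φ i θ)‖} ≤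
      ENNReal.ofReal (6 * (1 / τ + riemDiam Θ (dictKernel φ) T *
        (√(Fintype.card Z) * Real.exp (-Fintype.card Z / 2)) / √τ)) := by
  rcases T.eq_empty_or_nonempty with rfl | hne
  · simp
  obtain ⟨A, B, hAB, rfl⟩ : ∃ A B, A ≤ B ∧ T = Set.Icc A B := by
    have h1 := eq_Icc_of_connected_compact ⟨hne, hT.isPreconnected⟩ hTc
    refine ⟨_, _, ?_, h1⟩
    rw [h1] at hne
    exact Set.nonempty_Icc.1 hne
  have hsub : Set.Icc A B ⊆ Θ := hTS.trans hk.subset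
  set L := ∫ t in A..B, dictSpeed Θ φ t with hL
  have hL0 : 0 ≤ L := intervalIntegral.integral_nonneg hAB fun t _ => Real.sqrt_nonneg _
  have hLd : L ≤ riemDiam Θ (dictKernel φ) (Set.Icc A B) :=
    integral_dictSpeed_le_riemDiam hφ hAB hsub
  obtain ⟨hy1, hy2⟩ := chaining_tail_le_rate hn hτ hL0 hy
  have hτ0 : 0 < τ := by linarith
  set ε : ℝ := 2 * (1 / τ + riemDiam Θ (dictKernel φ) (Set.Icc A B) *
        (√(Fintype.card Z) * Real.exp (-Fintype.card Z / 2)) / √τ) with hε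
  have hone : ∀ i ≤ 2, P {ω | ∃ θ ∈ Set.Icc A B,
      4 * x < ‖noiseMap a (W ω) (featDeriv Θ φ i θ)‖} ≤ ENNReal.ofReal ε := fun i hi => by
    refine (hW.measure_exists_lt_norm_noiseMap_le (α := ‖a‖) (l := featBound Θ S k)
      (D := featDeriv Θ φ (i + 1)) ha (fun z => ?_) hapos hσ hΔ (featBound_pos _ _ _) hx hAB
      (hφ.contDiffOn_dictSpeed.continuousOn.mono hsub) (fun t _ => Real.sqrt_nonneg _)
      (fun t ht => (hφ.hasDerivWithinAt_featDeriv (by omega) (hsub ht)).mono hsub)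
      (fun t ht => norm_featDeriv_le hφ hk hTS hclose (by omega) ht)
      (fun t ht => norm_featDeriv_le hφ hk hTS hclose (by omega) ht) hy1).trans ?_
    · exact (Real.le_norm_self _).trans (norm_le_pi_norm a z)
    · refine ENNReal.ofReal_le_ofReal (hy2.trans ?_)
      rw [hε]
      gcongr
  have hunion : {ω | ∃ i ≤ 2, ∃ θ ∈ Set.Icc A B,
      4 * x < ‖noiseMap a (W ω) (featDeriv Θ φ i θ)‖} ⊆
      ⋃ i ∈ Finset.range 3, {ω | ∃ θ ∈ Set.Icc A B,
        4 * x < ‖noiseMap a (W ω) (featDeriv Θ φ i θ)‖} := by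
    rintro ω ⟨i, hi, h⟩
    exact Set.mem_iUnion₂.2 ⟨i, Finset.mem_range.2 (by omega), h⟩
  calc _ ≤ ∑ i ∈ Finset.range 3, P {ω | ∃ θ ∈ Set.Icc A B,
        4 * x < ‖noiseMap a (W ω) (featDeriv Θ φ i θ)‖} :=
        (measure_mono hunion).trans (measure_biUnion_finset_le _ _)
    _ ≤ ∑ _i ∈ Finset.range 3, ENNReal.ofReal ε :=
        Finset.sum_le_sum fun i hi => hone i (by have := Finset.mem_range.1 hi; omega)
    _ = _ := by
        rw [Finset.sum_const, Finset.card_range, nsmul_eq_mul, hε, ← ENNReal.ofReal_natCast,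
          ← ENNReal.ofReal_mul (by norm_num)]
        congr 1
        push_cast
        ring

end Event

end MixtureLasso

open MixtureLasso in
theorem corollary1 :
    ∃ F : ℕ → ℝ,
      (∃ c₁ c₂ : ℝ, 0 < c₁ ∧ 0 < c₂ ∧ ∀ n : ℕ, 1 ≤ n →
        c₁ * (√n * Real.exp (-n / 2)) ≤ F n ∧ F n ≤ c₂ * (√n * Real.exp (-n / 2))) ∧
      -- the interval, the limit kernel, the radius, and the constants of the certificates
      ∀ (Θ Θinf : Set ℝ) (Kinf : ℝ → ℝ → ℝ) (r CN CN' CF CB cN cF cB : ℝ),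
        Θ.OrdConnected → IsLimitKernel Θ Θinf Kinf →
        0 < r → 0 < CN → 0 < CN' → 0 < CF → CF < 1 → 0 < CB → 0 < cN → 0 < cF → 0 < cB →
        ∃ C₀ C₁ C₂ : ℝ, 0 < C₀ ∧ 0 < C₁ ∧ 0 < C₂ ∧
          -- the Hilbert space and the dictionary
          ∀ (H : Type*) [NormedAddCommGroup H] [InnerProductSpace ℝ H] [CompleteSpace H]
            (φ : ℝ → H) (ΘT : Set ℝ),
            IsRegularDictionary Θ φ → IsCompact ΘT → ΘT.OrdConnected → ΘT ⊆ Θinf →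
            KernelsClose Θ ΘT (dictKernel φ) Kinf
              (min (supDeriv Θ Θinf Kinf 2 2) (supH Θ Θinf Kinf)) →
          -- the index set of the signals and its weights
          ∀ (Z : Type*) [Fintype Z] [MeasurableSpace Z] [MeasurableSingletonClass Z]
            (a : Z → ℝ) (ν : Measure Z),
            (∀ z, 0 ≤ a z) → ν = ∑ z, ENNReal.ofReal (a z) • Measure.dirac z → ν ≠ 0 →
          -- the unknown parameters
          ∀ (K s : ℕ) (Bstar : Z → EuclideanSpace ℝ (Fin K)) (ϑstar : Fin K → ℝ),
            MemLp Bstar 2 ν → (∀ k, ϑstar k ∈ ΘT) → (activeSet ν Bstar).ncard = s →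
            InterpolatingCertificate Θ ΘT φ ν 2 2 s r (ϑstar '' activeSet ν Bstar)
              CN CN' CF CB →
            DerivativeCertificate Θ ΘT φ ν 2 2 s r (ϑstar '' activeSet ν Bstar) cN cF cB →
          -- the noise and the observation
          ∀ (Ω : Type*) [MeasurableSpace Ω] (P : Measure Ω) [IsProbabilityMeasure P]
            (σ Δ : ℝ) (W Y : Ω → Z → H),
            0 < σ → 0 < Δ → AdmissibleNoise P W σ Δ →
            (∀ᵐ ω ∂P, ∀ᵐ z ∂ν, Y ω z = mixture φ Bstar ϑstar z + W ω z) →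
          ∀ τ κ : ℝ, 1 < τ →
            C₁ * σ * √(‖a‖ * Δ * Fintype.card Z / ν.real Set.univ ^ 2)
              * (1 + √(1 + Real.log τ / Fintype.card Z)) ≤ κ →
            ∃ A : Set Ω, MeasurableSet A ∧
              1 - C₂ * (1 / τ + riemDiam Θ (dictKernel φ) ΘT * F (Fintype.card Z) / √τ)
                ≤ P.real A ∧
              ∀ ω ∈ A, ∀ (Bhat : Z → EuclideanSpace ℝ (Fin K)) (ϑhat : Fin K → ℝ),
                IsEstimator φ ΘT ν 2 κ (Y ω) Bhat ϑhat →
                1 / √(ν.real Set.univ)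
                    * normL 2 ν (mixture φ Bhat ϑhat - mixture φ Bstar ϑstar)
                  ≤ C₀ * √(s * ν.real Set.univ) * κ := by
  refine ⟨fun n => √n * Real.exp (-n / 2), ⟨1, 1, one_pos, one_pos, fun n _ => by simp⟩, ?_⟩
  intro Θ Θinf Kinf r CN CN' CF CB cN cF cB _ hKinf hr hCN hCN' hCF _ hCB hcN hcF hcB
  -- `m` is a common decay rate for the near and far regions, and `c` is the largest noise level,
  -- relative to `ν(Z) κ`, allowed by `prediction_error_le`.
  set m : ℝ := min CN CF with hm
  have hm0 : 0 < m := lt_min hCN hCF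
  set c : ℝ := m / (2 * (2 + CN' + cN + cF)) with hc
  have hc0 : 0 < c := by positivity
  have hl := featBound_pos Θ Θinf Kinf
  refine ⟨2 * ((m * (CB + cB) + CB) * (1 + (m + 2 * CN' + 2) / m)),
    8 * featBound Θ Θinf Kinf / c, 6, by positivity, by positivity, by norm_num, ?_⟩
  intro H _ _ _ φ ΘT hφ hTc hT hTinf hclose Z _ _ _ a ν ha hν hν0 K s Bstar ϑstar hB hϑ hs
    hP hQ Ω _ P _ σ Δ W Y hσ hΔ hW hY τ κ hτ hκ
  have hmass : ν.real Set.univ = ∑ z, a z := real_univ_sum_smul_dirac ha hν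
  have hane : a ≠ 0 := fun h => hν0 (by simp [hν, h])
  have hapos : 0 < ‖a‖ := norm_pos_iff.2 hane
  have hνpos : 0 < ν.real Set.univ := by
    rw [hmass]
    obtain ⟨z, hz⟩ := Function.ne_iff.1 hane
    exact Finset.sum_pos' (fun z _ => ha z)
      ⟨z, Finset.mem_univ z, lt_of_le_of_ne (ha z) (Ne.symm hz)⟩
  have hn : 1 ≤ Fintype.card Z := by
    obtain ⟨z, -⟩ := Function.ne_iff.1 hane
    exact Fintype.card_pos_iff.2 ⟨z⟩
  have hκ0 : 0 ≤ κ := le_trans (by positivity) hκ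
  have hexp := exponent_ge_of_penalty_ge hn hτ hσ hΔ hapos hl hc0 hνpos hκ
  have hbad := hW.measure_exists_lt_norm_featDeriv_le hφ hKinf hTinf hTc hT hclose ha hapos hσ hΔ
    hn hτ (by positivity) hexp
  have hYbad : P {ω | ¬ ∀ᵐ z ∂ν, Y ω z = mixture φ Bstar ϑstar z + W ω z} = 0 := hY
  have hdiam : 0 ≤ riemDiam Θ (dictKernel φ) ΘT := by
    refine Real.sSup_nonneg ?_
    rintro _ ⟨p, -, rfl⟩
    exact abs_nonneg _
  have hτ0 : 0 < τ := one_pos.trans hτ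
  have hunion := (measure_union_le _ _).trans (add_le_add hbad hYbad.le)
  rw [add_zero] at hunion
  obtain ⟨A, hA, hPA, hAbad⟩ := exists_measurableSet_of_measure_compl_le (by positivity) hunion
  refine ⟨A, hA, hPA, fun ω hω Bhat ϑhat hest => ?_⟩
  have hgood := hAbad ω hω
  rw [Set.mem_union, not_or] at hgood
  obtain ⟨hnoise, hYω⟩ := hgood
  replace hYω : ∀ᵐ z ∂ν, Y ω z = mixture φ Bstar ϑstar z + W ω z := not_not.1 hYω
  -- The noise level is `c ν(Z) κ`, written as `4 * x` because chaining at threshold `x` controls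
  -- the supremum by `4 * x`.
  have key := norm_mixture_sub_le hφ hT (hTinf.trans hKinf.subset) ha hν hνpos hr hm0
    (min_le_left _ _) (min_le_right _ _) hCN' hCB hcN hcF hcB hB hϑ hs hP hQ hYω hκ0
    (M := 4 * (c * (ν.real Set.univ * κ) / 4)) (fun i hi θ hθ => not_lt.1 fun h => hnoise ⟨i, hi, θ, hθ, h⟩)
    (by positivity) (by linarith) hest
  rw [normL_two_eq ha hν]
  have hsq : 0 < √(ν.real Set.univ) := Real.sqrt_pos.2 hνpos
  rw [one_div, inv_mul_le_iff₀ hsq, Real.sqrt_mul (Nat.cast_nonneg s)]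
  refine key.trans_eq ?_
  nth_rw 1 [← Real.mul_self_sqrt hνpos.le]
  ring
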